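/- Let $p\in(0,1)$ be a constant and, for each $n$, let $G_p$ be a random graph in the Erdős–Rényi model $\mathcal G_{n,p}$: a graph on $n$ labelled vertices in which each pair of distinct vertices is joined by an edge independently with probability $p$. For a connected graph $G$ on the vertices $1,\dots,n$, let $d_i$ be the degree of $i$, let $D(i,j)$ be the distance between $i$ and $j$ in $G$, and let $DD(G)$ be the real symmetric $n\times n$ matrix with entries $DD(G)(i,j)=(d_i+d_j)D(i,j)$ (so its diagonal is $0$). The energy $\mathscr E(M)$ of a real symmetric matrix $M$ is the sum of the absolute values of its eigenvalues, counted with multiplicity. Then $$\mathscr E(DD(G_p))=\Bigl(\frac{16}{3\pi}\,p\sqrt{p(1-p)}+o(1)\Bigr)n^{5/2}$$ with probability tending to $1$ as $n\to\infty$; that is, for every $\varepsilon>0$, the probability that $G_p$ is connected and $$\Bigl|\mathscr E(DD(G_p))-\frac{16}{3\pi}\,p\sqrt{p(1-p)}\;n^{5/2}\Bigr|\le\varepsilon\, n^{5/2}$$ tends to $1$ as $n\to\infty$. -/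

import Mathlib

open Filter Topology

/-- The energy of a real symmetric matrix: the sum of the absolute values of its eigenvalues,
counted with multiplicity. -/
noncomputable def matrixEnergy {V : Type*} [Fintype V] [DecidableEq V] (A : Matrix V V ℝ)
    (hA : A.IsHermitian) : ℝ :=
  ∑ i, |hA.eigenvalues i|

open Classical in
/-- The degree-distance matrix of a graph: its `(i, j)` entry is `(d_i + d_j) * D(i, j)`.
The diagonal is zero because `D(i, i) = 0`. (`SimpleGraph.dist` is `0` between vertices that lie in
different components, so this is the intended matrix for connected graphs.) -/
noncomputable def degreeDistanceMatrix {V : Type*} [Fintype V] (G : SimpleGraph V) :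
    Matrix V V ℝ :=
  Matrix.of fun i j => ((G.degree i : ℝ) + (G.degree j : ℝ)) * (G.dist i j : ℝ)

theorem degreeDistanceMatrix_isHermitian {V : Type*} [Fintype V] (G : SimpleGraph V) :
    (degreeDistanceMatrix G).IsHermitian := by
  refine Matrix.IsHermitian.ext fun i j => ?_
  simp only [degreeDistanceMatrix, Matrix.of_apply, star_trivial]
  rw [SimpleGraph.dist_comm, add_comm]

open MeasureTheory

/-! ### Edge resampling and integration by parts for the binomial random graph. -/

namespace SimpleGraph

variable {V : Type*}

/-! With high probability any two vertices have a common neighbour, by a union bound. Then G is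
connected and D(i,j) = 2 - A_ij off the diagonal. Write A_ij = p + B_ij for i ≠ j, d_i = np + e_i
and v = p(1-p). The matrix splits into -2np·B, a part (2-p)(d_i + d_j) of rank at most two, a part
-(e_i + e_j)B_ij and a diagonal correction. The energy is the maximum of tr(SM) over orthogonal S,
so the last three parts change it by O(n²) + O(√n ∑|e_i|), which is O(n²) in expectation because
E|e_i| = O(√n) (`abs_energy_degreeDistanceMatrix_sub_le`, `integral_abs_degree_sub_le`). It remains
to show that B/√n has normalized energy tending to (8/3π)√v (`tendsto_integral_abs_energy_sub`).

For this, |x| = (2/π) ∫_0^∞ x²/(x²+t²) dt reduces the energy to the Stieltjes transform m of the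
spectrum at the points it, t > 0. Working at a fixed point of the imaginary axis makes every bound
elementary. The semicircle law enters through the defect F = 1 + itm + vm². Its second moment is
computed directly: 1 + itm is a normalized sum of terms B_ij R_ji, and an exact integration by parts
in each edge turns E[B_ij R_ji F̄] into a discrete derivative, whose first-order part cancels
against E[vm² F̄] up to O(n^{-1/2}) (`integral_norm_sq_semicircleDefect_le`). Putting F̄ inside the
expectation removes the need for a separate concentration estimate.

The equation is stable: F factors through m - is, where is is the semicircle value, and the other
factor has modulus at least t (`abs_sub_semicircle_le`). Dominated convergence in t, with majorant
2/(1+t²), then gives convergence in L¹, and Markov's inequality finishes. -/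

instance measurableSingletonClass_of_countable [Countable V] :
    MeasurableSingletonClass (SimpleGraph V) where
  measurableSet_singleton G := by
    have h : ({G} : Set (SimpleGraph V)) = edgeSet ⁻¹' {G.edgeSet} := by
      ext H
      simp
    rw [h]
    exact measurable_edgeSet (measurableSet_singleton _)

theorem edge_le_of_adj {G : SimpleGraph V} {i j : V} (h : G.Adj i j) : edge i j ≤ G := by
  intro a b hab
  rcases (edge_adj i j a b).1 hab with ⟨⟨rfl, rfl⟩ | ⟨rfl, rfl⟩, -⟩
  · exact h
  · exact h.symm

theorem disjoint_edge_of_not_adj {G : SimpleGraph V} {i j : V} (h : ¬ G.Adj i j) :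
    Disjoint G (edge i j) := by
  rw [disjoint_iff_inf_le]
  rintro a b ⟨h1, h2⟩
  rcases (edge_adj i j a b).1 h2 with ⟨⟨rfl, rfl⟩ | ⟨rfl, rfl⟩, -⟩
  · exact h h1
  · exact h h1.symm

/-- Adding the edge `ij` multiplies the probability of a graph by `p / (1 - p)`. -/
theorem binomialRandom_real_sup_edge [Fintype V] (p : unitInterval) {G : SimpleGraph V} {i j : V}
    (hij : i ≠ j) (h : ¬ G.Adj i j) :
    (1 - (p : ℝ)) * (binomialRandom V p).real {G ⊔ edge i j} =
      p * (binomialRandom V p).real {G} := by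
  classical
  have hcard : (G ⊔ edge i j).edgeSet.ncard = G.edgeSet.ncard + 1 := by
    have := card_edgeFinset_sup_edge G h hij
    rw [← coe_edgeFinset, ← coe_edgeFinset, Set.ncard_coe_finset, Set.ncard_coe_finset]
    convert this
  have hle : (G ⊔ edge i j).edgeSet.ncard ≤ (Nat.card V).choose 2 := by
    rw [← coe_edgeFinset, Set.ncard_coe_finset, Nat.card_eq_fintype_card]
    exact card_edgeFinset_le_card_choose_two
  obtain ⟨k, hk⟩ := Nat.exists_eq_add_of_le hle
  have h1 : (Nat.card V).choose 2 - (G ⊔ edge i j).edgeSet.ncard = k := by omega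
  have h2 : (Nat.card V).choose 2 - G.edgeSet.ncard = k + 1 := by omega
  rw [hcard] at h1
  simp only [Measure.real, binomialRandom_singleton, h1, h2, hcard, ENNReal.toReal_mul,
    ENNReal.toReal_pow, ENNReal.coe_toReal, unitInterval.coe_toNNReal, unitInterval.coe_symm_eq]
  ring

theorem sup_edge_symmDiff {G : SimpleGraph V} (i j : V) :
    symmDiff G (edge i j) ⊔ edge i j = G ⊔ edge i j := by
  ext a b
  simp only [symmDiff_def, sup_adj, sdiff_adj]
  tauto

theorem symmDiff_sdiff_edge {G : SimpleGraph V} (i j : V) :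
    symmDiff G (edge i j) \ edge i j = G \ edge i j := by
  rw [symmDiff_def, sup_sdiff]
  simp

/-- Resampling one edge leaves the law of the binomial random graph unchanged. -/
theorem integral_binomialRandom_resample [Fintype V] {E : Type*} [NormedAddCommGroup E]
    [NormedSpace ℝ E] [CompleteSpace E] (p : unitInterval) {i j : V} (hij : i ≠ j)
    (h : SimpleGraph V → E) :
    ∫ G, h G ∂(binomialRandom V p) =
      ∫ G, ((p : ℝ) • h (G ⊔ edge i j) + (1 - (p : ℝ)) • h (G \ edge i j))
        ∂(binomialRandom V p) := by
  let _ : Fintype (SimpleGraph V) := Fintype.ofFinite _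
  rw [integral_fintype .of_finite, integral_fintype .of_finite]
  -- Toggling the edge is an involution. After both sums are doubled, the identity holds for each
  -- pair {G, τ G} separately, since the two weights are in the ratio p : (1 - p).
  let τ : Equiv.Perm (SimpleGraph V) :=
    Function.Involutive.toPerm (fun G => symmDiff G (edge i j))
      (fun G => symmDiff_symmDiff_cancel_right _ _)
  have key (f : SimpleGraph V → E) : (2 : ℝ) • ∑ G, f G = ∑ G, (f G + f (τ G)) := by
    rw [Finset.sum_add_distrib, Equiv.sum_comp τ f, two_smul]
  have h2 : (2 : ℝ) ≠ 0 := two_ne_zero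
  apply smul_right_injective E h2
  simp only
  rw [key, key]
  refine Finset.sum_congr rfl fun G _ => ?_
  have hτ : τ G = symmDiff G (edge i j) := rfl
  rw [hτ, sup_edge_symmDiff, symmDiff_sdiff_edge]
  by_cases hG : G.Adj i j
  · have hle := edge_le_of_adj hG
    have h3 : symmDiff G (edge i j) = G \ edge i j := symmDiff_of_ge hle
    have h4 : G ⊔ edge i j = G := sup_eq_left.2 hle
    have h5 : ¬ (G \ edge i j).Adj i j := by simp [edge_adj, hij]
    have h6 := binomialRandom_real_sup_edge p hij h5
    rw [sdiff_sup_cancel hle] at h6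
    rw [h3, h4]
    simp only [smul_add, smul_smul]
    rw [add_add_add_comm, ← add_smul, ← add_smul]
    congr 2 <;> first | linear_combination h6 | linear_combination -h6
  · have hd := disjoint_edge_of_not_adj hG
    have h3 : symmDiff G (edge i j) = G ⊔ edge i j := hd.symmDiff_eq_sup
    have h4 : G \ edge i j = G := hd.sdiff_eq_left
    have h6 := binomialRandom_real_sup_edge p hij hG
    rw [h3, h4]
    simp only [smul_add, smul_smul]
    rw [add_add_add_comm, ← add_smul, ← add_smul, add_comm]
    congr 2 <;> first | linear_combination h6 | linear_combination -h6

/-- The centred adjacency matrix of a graph: `A_ij - p` off the diagonal, and `0` on it. -/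
noncomputable def centeredAdj (p : ℝ) (G : SimpleGraph V) : Matrix V V ℝ := by
  classical
  exact Matrix.of fun i j => if i = j then 0 else (if G.Adj i j then 1 else 0) - p

theorem centeredAdj_self (p : ℝ) (G : SimpleGraph V) (i : V) : centeredAdj p G i i = 0 := by
  simp [centeredAdj]

open Classical in
theorem centeredAdj_of_ne (p : ℝ) (G : SimpleGraph V) {i j : V} (h : i ≠ j) :
    centeredAdj p G i j = (if G.Adj i j then 1 else 0) - p := by
  simp [centeredAdj, h]

theorem centeredAdj_symm (p : ℝ) (G : SimpleGraph V) (i j : V) :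
    centeredAdj p G i j = centeredAdj p G j i := by
  by_cases h : i = j
  · rw [h]
  · rw [centeredAdj_of_ne p G h, centeredAdj_of_ne p G (Ne.symm h), adj_comm]

theorem abs_centeredAdj_le {p : ℝ} (hp : p ∈ Set.Icc (0 : ℝ) 1) (G : SimpleGraph V) (i j : V) :
    |centeredAdj p G i j| ≤ 1 := by
  by_cases h : i = j
  · rw [h, centeredAdj_self]; simp
  · rw [centeredAdj_of_ne p G h, abs_le]
    obtain ⟨h0, h1⟩ := hp
    split_ifs <;> constructor <;> linarith

/-- Modifying the edge `ij` is a perturbation of the centred adjacency matrix supported on the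
entries `(i, j)` and `(j, i)`. -/
theorem centeredAdj_eq_add [DecidableEq V] (p : ℝ) {G H : SimpleGraph V} {i j : V} (hij : i ≠ j)
    (h : ∀ a b, ¬ (edge i j).Adj a b → (G.Adj a b ↔ H.Adj a b)) :
    centeredAdj p H = centeredAdj p G + (centeredAdj p H i j - centeredAdj p G i j) •
      (Matrix.single i j (1 : ℝ) + Matrix.single j i 1) := by
  ext a b
  simp only [Matrix.add_apply, Matrix.smul_apply, Matrix.single_apply, smul_eq_mul]
  by_cases hab : a = b
  · subst hab
    have h1 : ¬ (i = a ∧ j = a) := fun h => hij (h.1.trans h.2.symm)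
    have h2 : ¬ (j = a ∧ i = a) := fun h => hij (h.2.trans h.1.symm)
    simp [centeredAdj_self, h1, h2]
  · by_cases he : (edge i j).Adj a b
    · rcases (edge_adj i j a b).1 he with ⟨⟨rfl, rfl⟩ | ⟨rfl, rfl⟩, -⟩
      · simp [hab]
      · simp [hab, centeredAdj_symm p _ b a]
    · have h1 : ¬ (i = a ∧ j = b) := fun hh => he ((edge_adj i j a b).2 ⟨Or.inl ⟨hh.1.symm, hh.2.symm⟩, hab⟩)
      have h2 : ¬ (j = a ∧ i = b) := fun hh => he ((edge_adj i j a b).2 ⟨Or.inr ⟨hh.1.symm, hh.2.symm⟩, hab⟩)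
      have h3 := h a b he
      rw [centeredAdj_of_ne p _ hab, centeredAdj_of_ne p _ hab]
      by_cases hG : G.Adj a b
      · simp [h1, h2, hG, h3.1 hG]
      · simp [h1, h2, hG, mt h3.2 hG]

/-- Exact integration by parts for a centred Bernoulli entry. -/
theorem integral_centeredAdj_smul [Fintype V] {E : Type*} [NormedAddCommGroup E]
    [NormedSpace ℝ E] [CompleteSpace E] (p : unitInterval) {i j : V} (hij : i ≠ j)
    (f : SimpleGraph V → E) :
    ∫ G, centeredAdj p G i j • f G ∂(binomialRandom V p) =
      ((p : ℝ) * (1 - p)) • ∫ G, (f (G ⊔ edge i j) - f (G \ edge i j))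
        ∂(binomialRandom V p) := by
  rw [integral_binomialRandom_resample p hij, ← integral_smul]
  congr 1 with G
  have h1 : centeredAdj p (G ⊔ edge i j) i j = 1 - p := by
    rw [centeredAdj_of_ne _ _ hij]; simp [edge_adj, hij]
  have h2 : centeredAdj p (G \ edge i j) i j = - p := by
    rw [centeredAdj_of_ne _ _ hij]; simp [edge_adj, hij]
  rw [h1, h2]
  module

theorem centeredAdj_sup_edge [DecidableEq V] (p : ℝ) (G : SimpleGraph V) {i j : V} (hij : i ≠ j) :
    centeredAdj p (G ⊔ edge i j) = centeredAdj p (G \ edge i j) +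
      (1 : ℝ) • (Matrix.single i j (1 : ℝ) + Matrix.single j i 1) := by
  classical
  rw [centeredAdj_eq_add p (G := G \ edge i j) (H := G ⊔ edge i j) hij
    (fun a b hab => by simp [hab])]
  congr 2
  rw [centeredAdj_of_ne _ _ hij, centeredAdj_of_ne _ _ hij]
  simp [edge_adj, hij]

/-- Integration by parts produces the graphs with and without the edge. This compares them with G
itself, whichever of the two it is. -/
theorem exists_centeredAdj_sup_edge [DecidableEq V] (p : ℝ) (G : SimpleGraph V) {i j : V}
    (hij : i ≠ j) : ∃ c : ℝ, |c| ≤ 1 ∧ centeredAdj p (G ⊔ edge i j) = centeredAdj p G +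
      c • (Matrix.single i j (1 : ℝ) + Matrix.single j i 1) := by
  classical
  refine ⟨_, ?_, centeredAdj_eq_add p hij (fun a b hab => by simp [hab])⟩
  rw [centeredAdj_of_ne _ _ hij, centeredAdj_of_ne _ _ hij]
  by_cases h : G.Adj i j <;> simp [edge_adj, hij, h]

theorem exists_centeredAdj_sdiff_edge [DecidableEq V] (p : ℝ) (G : SimpleGraph V) {i j : V}
    (hij : i ≠ j) : ∃ c : ℝ, |c| ≤ 1 ∧ centeredAdj p (G \ edge i j) = centeredAdj p G +
      c • (Matrix.single i j (1 : ℝ) + Matrix.single j i 1) := by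
  classical
  refine ⟨_, ?_, centeredAdj_eq_add p hij (fun a b hab => by simp [hab])⟩
  rw [centeredAdj_of_ne _ _ hij, centeredAdj_of_ne _ _ hij]
  by_cases h : G.Adj i j
  · rw [if_neg (by simp [edge_adj, hij]), if_pos h, abs_le]
    constructor <;> linarith
  · simp [h]

end SimpleGraph

/-- The Cauchy–Schwarz bound `E|f| ≤ √(E f²)` on a finite probability space. -/
theorem integral_abs_le_sqrt_integral_sq {Ω : Type*} [MeasurableSpace Ω]
    [Finite Ω] [MeasurableSingletonClass Ω] (μ : Measure Ω) [IsProbabilityMeasure μ] (f : Ω → ℝ) :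
    ∫ x, |f x| ∂μ ≤ Real.sqrt (∫ x, f x ^ 2 ∂μ) := by
  apply Real.le_sqrt_of_sq_le
  set m := ∫ x, |f x| ∂μ with hm
  have h : 0 ≤ ∫ x, (|f x| - m) ^ 2 ∂μ := integral_nonneg fun x => sq_nonneg _
  have h2 : ∫ x, (|f x| - m) ^ 2 ∂μ = ∫ x, f x ^ 2 ∂μ - m ^ 2 := by
    have : ∀ x, (|f x| - m) ^ 2 = f x ^ 2 - (2 * m) * |f x| + m ^ 2 := fun x => by
      rw [sub_sq, sq_abs]; ring
    simp only [this]
    rw [integral_add .of_finite .of_finite, integral_sub .of_finite .of_finite,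
      integral_const_mul, ← hm]
    simp
    ring
  linarith

/-! ### Resolvents on the imaginary axis and their rank-two perturbations. -/

namespace Matrix

variable {V : Type*} [Fintype V] [DecidableEq V]

theorem IsHermitian.eq_mul_diagonal_mul_transpose {M : Matrix V V ℝ} (hM : M.IsHermitian) :
    M = (hM.eigenvectorUnitary : Matrix V V ℝ) * diagonal hM.eigenvalues *
      (hM.eigenvectorUnitary : Matrix V V ℝ)ᵀ := by
  have h := hM.spectral_theorem
  rw [Unitary.conjStarAlgAut_apply] at h
  exact h

/-- The resolvent `(M - i t)⁻¹` of a real matrix at a point of the imaginary axis. -/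
noncomputable def imResolvent (M : Matrix V V ℝ) (t : ℝ) : Matrix V V ℂ :=
  (M.map (fun x : ℝ => (x : ℂ)) - ((t : ℂ) * Complex.I) • (1 : Matrix V V ℂ))⁻¹

theorem ofReal_sub_mul_I_ne_zero (x : ℝ) {t : ℝ} (ht : t ≠ 0) :
    (x : ℂ) - (t : ℂ) * Complex.I ≠ 0 := by
  intro h
  have := congrArg Complex.im h
  simp at this
  exact ht this

theorem map_ofReal_mul {V : Type*} [Fintype V] (A B : Matrix V V ℝ) : (A * B).map (fun x : ℝ => (x : ℂ)) =
    A.map (fun x : ℝ => (x : ℂ)) * B.map (fun x : ℝ => (x : ℂ)) :=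
  Matrix.map_mul (f := Complex.ofRealHom)

/-- The spectral theorem supplies the inverse explicitly: real eigenvalues shifted by -it with t ≠ 0
never vanish. -/
theorem IsHermitian.imResolvent_eq {M : Matrix V V ℝ} (hM : M.IsHermitian) {t : ℝ} (ht : t ≠ 0) :
    (M.map (fun x : ℝ => (x : ℂ)) - ((t : ℂ) * Complex.I) • (1 : Matrix V V ℂ)) *
      ((hM.eigenvectorUnitary : Matrix V V ℝ).map (fun x : ℝ => (x : ℂ)) *
        diagonal (fun k => ((hM.eigenvalues k : ℂ) - (t : ℂ) * Complex.I)⁻¹) *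
        ((hM.eigenvectorUnitary : Matrix V V ℝ)ᵀ).map (fun x : ℝ => (x : ℂ))) = 1 := by
  set U := (hM.eigenvectorUnitary : Matrix V V ℝ) with hU
  have hUU : Uᵀ * U = 1 := Unitary.coe_star_mul_self hM.eigenvectorUnitary
  have hUU' : U * Uᵀ = 1 := Unitary.coe_mul_star_self hM.eigenvectorUnitary
  set c : Matrix V V ℝ → Matrix V V ℂ := fun A => A.map (fun x : ℝ => (x : ℂ)) with hc
  have c1 : c 1 = 1 := by simp [hc]
  have e1 : c Uᵀ * c U = 1 := by rw [← c1, ← hUU]; exact (map_ofReal_mul _ _).symm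
  have e2 : c U * c Uᵀ = 1 := by rw [← c1, ← hUU']; exact (map_ofReal_mul _ _).symm
  have hMc : c M = c U * diagonal (fun k => (hM.eigenvalues k : ℂ)) * c Uᵀ := by
    conv_lhs => rw [hM.eq_mul_diagonal_mul_transpose]
    simp only [hc, map_ofReal_mul]
    congr 2
    ext i j
    by_cases h : i = j <;> simp [diagonal, h]
  have h2 : c M - ((t : ℂ) * Complex.I) • (1 : Matrix V V ℂ) =
      c U * diagonal (fun k => (hM.eigenvalues k : ℂ) - (t : ℂ) * Complex.I) * c Uᵀ := by
    have h3 : diagonal (fun k => (hM.eigenvalues k : ℂ) - (t : ℂ) * Complex.I) =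
        diagonal (fun k => (hM.eigenvalues k : ℂ)) - ((t : ℂ) * Complex.I) • (1 : Matrix V V ℂ) := by
      ext i j
      by_cases h : i = j <;> simp [diagonal, h]
    rw [h3, mul_sub, sub_mul, ← hMc, mul_smul_comm, mul_one, smul_mul_assoc, e2]
  change (c M - ((t : ℂ) * Complex.I) • (1 : Matrix V V ℂ)) * (c U * _ * c Uᵀ) = 1
  rw [h2]
  calc _ = c U * (diagonal (fun k => (hM.eigenvalues k : ℂ) - (t : ℂ) * Complex.I) *
      (c Uᵀ * c U) * diagonal (fun k => ((hM.eigenvalues k : ℂ) - (t : ℂ) * Complex.I)⁻¹)) * c Uᵀ := by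
        simp only [mul_assoc]
    _ = 1 := by
        rw [e1, mul_one, diagonal_mul_diagonal]
        have : (fun k => ((hM.eigenvalues k : ℂ) - (t : ℂ) * Complex.I) *
          ((hM.eigenvalues k : ℂ) - (t : ℂ) * Complex.I)⁻¹) = 1 := by
          ext k
          exact mul_inv_cancel₀ (ofReal_sub_mul_I_ne_zero _ ht)
        rw [this, show diagonal (1 : V → ℂ) = 1 from diagonal_one, mul_one, e2]

theorem IsHermitian.mul_imResolvent {M : Matrix V V ℝ} (hM : M.IsHermitian) {t : ℝ} (ht : t ≠ 0) :
    (M.map (fun x : ℝ => (x : ℂ)) - ((t : ℂ) * Complex.I) • (1 : Matrix V V ℂ)) *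
      imResolvent M t = 1 := by
  rw [imResolvent, inv_eq_right_inv (hM.imResolvent_eq ht)]
  exact hM.imResolvent_eq ht

theorem IsHermitian.imResolvent_mul {M : Matrix V V ℝ} (hM : M.IsHermitian) {t : ℝ} (ht : t ≠ 0) :
    imResolvent M t *
      (M.map (fun x : ℝ => (x : ℂ)) - ((t : ℂ) * Complex.I) • (1 : Matrix V V ℂ)) = 1 :=
  mul_eq_one_comm.1 (hM.mul_imResolvent ht)

theorem IsHermitian.trace_imResolvent {M : Matrix V V ℝ} (hM : M.IsHermitian) {t : ℝ}
    (ht : t ≠ 0) : (imResolvent M t).trace =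
      ∑ k, ((hM.eigenvalues k : ℂ) - (t : ℂ) * Complex.I)⁻¹ := by
  have hUU : (hM.eigenvectorUnitary : Matrix V V ℝ)ᵀ * (hM.eigenvectorUnitary : Matrix V V ℝ) = 1 :=
    Unitary.coe_star_mul_self hM.eigenvectorUnitary
  rw [imResolvent, inv_eq_right_inv (hM.imResolvent_eq ht), trace_mul_comm, ← mul_assoc,
    ← map_ofReal_mul, hUU]
  simp [trace]

/-- The resolvent of a real symmetric matrix is complex symmetric, not Hermitian; this lets row
bounds serve for columns. -/
theorem IsHermitian.imResolvent_apply_comm {M : Matrix V V ℝ} (hM : M.IsHermitian) (t : ℝ)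
    (i j : V) : imResolvent M t i j = imResolvent M t j i := by
  have h : (imResolvent M t)ᵀ = imResolvent M t := by
    have hT : Mᵀ = M := by simpa [IsHermitian, conjTranspose_eq_transpose_of_trivial] using hM
    rw [imResolvent, transpose_nonsing_inv]
    congr 1
    rw [transpose_sub, transpose_smul, transpose_one, ← transpose_map, hT]
  exact congrFun (congrFun h j) i

/-- The Ward identity on the imaginary axis. -/
theorem IsHermitian.sum_norm_sq_imResolvent {M : Matrix V V ℝ} (hM : M.IsHermitian) {t : ℝ}
    (ht : 0 < t) (i : V) : ∑ j, ‖imResolvent M t i j‖ ^ 2 = (imResolvent M t i i).im / t := by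
  set R := imResolvent M t with hR
  set X : Matrix V V ℂ := M.map (fun x : ℝ => (x : ℂ)) with hX
  have h1 : R * (X - ((t : ℂ) * Complex.I) • (1 : Matrix V V ℂ)) = 1 := hM.imResolvent_mul ht.ne'
  have h2 : (X + ((t : ℂ) * Complex.I) • (1 : Matrix V V ℂ)) * Rᴴ = 1 := by
    have h3 := congrArg (fun A : Matrix V V ℂ => Aᴴ) h1
    have hXX : Xᴴ = X := by
      ext a b
      simp only [hX, conjTranspose_apply, map_apply]
      rw [← hM.apply a b]
      simp
    rw [conjTranspose_mul, conjTranspose_one, conjTranspose_sub, conjTranspose_smul, hXX,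
      conjTranspose_one] at h3
    simpa [sub_neg_eq_add] using h3
  have h3 : R - Rᴴ = (2 * (t : ℂ) * Complex.I) • (R * Rᴴ) := by
    calc R - Rᴴ = R * ((X + ((t : ℂ) * Complex.I) • (1 : Matrix V V ℂ)) * Rᴴ) -
        (R * (X - ((t : ℂ) * Complex.I) • (1 : Matrix V V ℂ))) * Rᴴ := by
          rw [h1, h2, mul_one, one_mul]
      _ = R * ((2 * (t : ℂ) * Complex.I) • (1 : Matrix V V ℂ)) * Rᴴ := by
          rw [mul_assoc, mul_assoc, ← mul_sub, ← sub_mul]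
          congr 2
          module
      _ = _ := by simp
  have h4 := congrArg Complex.im (congrFun (congrFun h3 i) i)
  have h5 : (R * Rᴴ) i i = ((∑ j, ‖R i j‖ ^ 2 : ℝ) : ℂ) := by
    rw [mul_apply]
    push_cast
    refine Finset.sum_congr rfl fun j _ => ?_
    rw [conjTranspose_apply]
    exact Complex.mul_conj' _
  simp only [sub_apply, conjTranspose_apply, smul_apply, smul_eq_mul, h5] at h4
  rw [show (2 * (t : ℂ) * Complex.I) * ((∑ j, ‖R i j‖ ^ 2 : ℝ) : ℂ) =
    ((2 * t * ∑ j, ‖R i j‖ ^ 2 : ℝ) : ℂ) * Complex.I by push_cast; ring] at h4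
  simp only [Complex.sub_im, Complex.star_def, Complex.conj_im, Complex.mul_I_im,
    Complex.ofReal_re] at h4
  rw [eq_div_iff ht.ne']
  linarith

/-- The Ward identity gives |R_ii|² ≤ Im R_ii / t ≤ |R_ii| / t, so no operator norm is needed. -/
theorem IsHermitian.norm_imResolvent_diag_le {M : Matrix V V ℝ} (hM : M.IsHermitian) {t : ℝ}
    (ht : 0 < t) (i : V) : ‖imResolvent M t i i‖ ≤ 1 / t := by
  have h := hM.sum_norm_sq_imResolvent ht i
  have h1 : ‖imResolvent M t i i‖ ^ 2 ≤ ∑ j, ‖imResolvent M t i j‖ ^ 2 :=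
    Finset.single_le_sum (f := fun j => ‖imResolvent M t i j‖ ^ 2)
      (fun j _ => sq_nonneg _) (Finset.mem_univ i)
  have h2 : (imResolvent M t i i).im ≤ ‖imResolvent M t i i‖ :=
    (le_abs_self _).trans (Complex.abs_im_le_norm _)
  have h3 : ‖imResolvent M t i i‖ ^ 2 ≤ ‖imResolvent M t i i‖ / t :=
    h1.trans (h.le.trans (by gcongr))
  rcases (norm_nonneg (imResolvent M t i i)).eq_or_lt with h4 | h4
  · rw [← h4]; positivity
  · rw [le_div_iff₀ ht] at h3 ⊢
    nlinarith

theorem IsHermitian.sum_norm_sq_imResolvent_le {M : Matrix V V ℝ} (hM : M.IsHermitian) {t : ℝ}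
    (ht : 0 < t) (i : V) : ∑ j, ‖imResolvent M t i j‖ ^ 2 ≤ 1 / t ^ 2 := by
  rw [hM.sum_norm_sq_imResolvent ht i]
  have h2 : (imResolvent M t i i).im ≤ 1 / t :=
    ((le_abs_self _).trans (Complex.abs_im_le_norm _)).trans (hM.norm_imResolvent_diag_le ht i)
  calc _ ≤ (1 / t) / t := by gcongr
    _ = _ := by field_simp

theorem IsHermitian.norm_imResolvent_le {M : Matrix V V ℝ} (hM : M.IsHermitian) {t : ℝ}
    (ht : 0 < t) (i j : V) : ‖imResolvent M t i j‖ ≤ 1 / t := by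
  have h1 : ‖imResolvent M t i j‖ ^ 2 ≤ ∑ j, ‖imResolvent M t i j‖ ^ 2 :=
    Finset.single_le_sum (f := fun j => ‖imResolvent M t i j‖ ^ 2)
      (fun j _ => sq_nonneg _) (Finset.mem_univ j)
  have h2 := h1.trans (hM.sum_norm_sq_imResolvent_le ht i)
  exact (sq_le_sq₀ (norm_nonneg _) (by positivity)).1 (by rw [_root_.one_div_pow]; exact h2)

theorem IsHermitian.im_imResolvent_nonneg {M : Matrix V V ℝ} (hM : M.IsHermitian) {t : ℝ}
    (ht : 0 < t) (i : V) : 0 ≤ (imResolvent M t i i).im := by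
  have h := hM.sum_norm_sq_imResolvent ht i
  rw [eq_div_iff ht.ne'] at h
  rw [← h]
  positivity

/-- The first resolvent identity for a perturbation of the entries `(i, j)` and `(j, i)`. -/
theorem IsHermitian.imResolvent_sub_apply {M N : Matrix V V ℝ} (hM : M.IsHermitian)
    (hN : N.IsHermitian) {t : ℝ} (ht : t ≠ 0) {i j : V} {c : ℝ}
    (h : N = M + c • (single i j (1 : ℝ) + single j i 1)) (a b : V) :
    imResolvent N t a b - imResolvent M t a b =
      -(c : ℂ) * (imResolvent N t a i * imResolvent M t j b +
        imResolvent N t a j * imResolvent M t i b) := by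
  set R := imResolvent M t with hR
  set S := imResolvent N t with hS
  set z : Matrix V V ℂ := ((t : ℂ) * Complex.I) • (1 : Matrix V V ℂ) with hz
  have h1 : (M.map (fun x : ℝ => (x : ℂ)) - z) * R = 1 := hM.mul_imResolvent ht
  have h2 : S * (N.map (fun x : ℝ => (x : ℂ)) - z) = 1 := hN.imResolvent_mul ht
  have h3 : N.map (fun x : ℝ => (x : ℂ)) = M.map (fun x : ℝ => (x : ℂ)) +
      (c : ℂ) • (single i j (1 : ℂ) + single j i 1) := by
    ext a b
    simp only [h, map_apply, add_apply, smul_apply, single_apply, smul_eq_mul]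
    push_cast
    split_ifs <;> simp
  have h4 : S - R = -(c : ℂ) • (S * (single i j (1 : ℂ) + single j i 1) * R) := by
    calc S - R = S * ((M.map (fun x : ℝ => (x : ℂ)) - z) * R) -
          (S * (N.map (fun x : ℝ => (x : ℂ)) - z)) * R := by rw [h1, h2, mul_one, one_mul]
      _ = S * (-(c : ℂ) • (single i j (1 : ℂ) + single j i 1)) * R := by
          rw [mul_assoc, mul_assoc, ← mul_sub, ← sub_mul, h3]
          congr 2
          module
      _ = _ := by simp only [mul_smul_comm, smul_mul_assoc]
  have h5 := congrFun (congrFun h4 a) b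
  rw [sub_apply] at h5
  rw [h5]
  simp only [smul_apply, mul_add, add_mul, add_apply, smul_eq_mul]
  have e (i j : V) : (S * single i j (1 : ℂ) * R) a b = S a i * R j b := by
    rw [mul_assoc, mul_apply, Finset.sum_eq_single i]
    · simp
    · intro k _ hk
      rw [single_mul_apply_of_ne _ _ _ _ _ hk, mul_zero]
    · simp
  rw [e, e]

theorem IsHermitian.norm_imResolvent_sub_le {M N : Matrix V V ℝ} (hM : M.IsHermitian)
    (hN : N.IsHermitian) {t : ℝ} (ht : 0 < t) {i j : V} {c : ℝ}
    (h : N = M + c • (single i j (1 : ℝ) + single j i 1)) (a b : V) :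
    ‖imResolvent N t a b - imResolvent M t a b‖ ≤ |c| * (2 / t ^ 2) := by
  rw [hM.imResolvent_sub_apply hN ht.ne' h, norm_mul, norm_neg, Complex.norm_real,
    Real.norm_eq_abs]
  gcongr
  refine (norm_add_le _ _).trans ?_
  rw [norm_mul, norm_mul]
  have e (a b c d : V) : ‖imResolvent N t a b‖ * ‖imResolvent M t c d‖ ≤ 1 / t * (1 / t) := by
    gcongr
    · exact hN.norm_imResolvent_le ht _ _
    · exact hM.norm_imResolvent_le ht _ _
  refine (add_le_add (e _ _ _ _) (e _ _ _ _)).trans (le_of_eq ?_)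
  field_simp
  norm_num

/-- Summing the entrywise bound would cost a factor n. The trace instead collapses to inner products
of resolvent rows, which Cauchy–Schwarz and the Ward identity bound independently of n. -/
theorem IsHermitian.norm_trace_imResolvent_sub_le {M N : Matrix V V ℝ} (hM : M.IsHermitian)
    (hN : N.IsHermitian) {t : ℝ} (ht : 0 < t) {i j : V} {c : ℝ}
    (h : N = M + c • (single i j (1 : ℝ) + single j i 1)) :
    ‖(imResolvent N t).trace - (imResolvent M t).trace‖ ≤ |c| * (2 / t ^ 2) := by
  have h1 : (imResolvent N t).trace - (imResolvent M t).trace = -(c : ℂ) *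
      (∑ a, imResolvent N t i a * imResolvent M t j a +
        ∑ a, imResolvent N t j a * imResolvent M t i a) := by
    rw [trace, trace, ← Finset.sum_sub_distrib, ← Finset.sum_add_distrib, Finset.mul_sum]
    refine Finset.sum_congr rfl fun a _ => ?_
    rw [diag_apply, diag_apply, hM.imResolvent_sub_apply hN ht.ne' h,
      hN.imResolvent_apply_comm t a i, hN.imResolvent_apply_comm t a j]
  have e (i j : V) : ‖∑ a, imResolvent N t i a * imResolvent M t j a‖ ≤ 1 / t ^ 2 := by
    refine (norm_sum_le _ _).trans ?_
    simp only [norm_mul]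
    have h2 := Finset.sum_mul_sq_le_sq_mul_sq Finset.univ (fun a => ‖imResolvent N t i a‖)
      (fun a => ‖imResolvent M t j a‖)
    have h3 : (∑ a, ‖imResolvent N t i a‖ * ‖imResolvent M t j a‖) ^ 2 ≤ (1 / t ^ 2) ^ 2 := by
      refine h2.trans ?_
      rw [sq (1 / t ^ 2)]
      gcongr
      · exact hN.sum_norm_sq_imResolvent_le ht i
      · exact hM.sum_norm_sq_imResolvent_le ht j
    exact (abs_le_of_sq_le_sq' h3 (by positivity)).2
  rw [h1, norm_mul, norm_neg, Complex.norm_real, Real.norm_eq_abs]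
  gcongr
  refine (norm_add_le _ _).trans ((add_le_add (e _ _) (e _ _)).trans (le_of_eq ?_))
  ring

end Matrix

/-! ### The Stieltjes transform and the defect in its self-consistent equation. -/

namespace Matrix

variable {V : Type*} [Fintype V] [DecidableEq V]

/-- The Stieltjes transform, at a point of the imaginary axis, of the empirical spectral measure. -/
noncomputable def imStieltjes (M : Matrix V V ℝ) (t : ℝ) : ℂ :=
  (Fintype.card V : ℂ)⁻¹ * (imResolvent M t).trace

/-- The defect in the self-consistent equation of the semicircle law of variance `v`. -/
noncomputable def semicircleDefect (v : ℝ) (M : Matrix V V ℝ) (t : ℝ) : ℂ :=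
  1 + ((t : ℂ) * Complex.I) * imStieltjes M t + (v : ℂ) * imStieltjes M t ^ 2

theorem IsHermitian.norm_imStieltjes_le {M : Matrix V V ℝ} (hM : M.IsHermitian) {t : ℝ}
    (ht : 0 < t) : ‖imStieltjes M t‖ ≤ 1 / t := by
  have h : ‖(imResolvent M t).trace‖ ≤ Fintype.card V * (1 / t) := by
    refine (norm_sum_le _ _).trans ?_
    refine (Finset.sum_le_sum fun i _ => hM.norm_imResolvent_diag_le ht i).trans ?_
    simp
  rw [imStieltjes, norm_mul, norm_inv, Complex.norm_natCast]
  rcases (Nat.cast_nonneg (α := ℝ) (Fintype.card V)).eq_or_lt with h0 | h0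
  · rw [← h0]; simp; positivity
  · rw [inv_mul_le_iff₀ h0]; exact h

theorem IsHermitian.im_imStieltjes_nonneg {M : Matrix V V ℝ} (hM : M.IsHermitian) {t : ℝ}
    (ht : 0 < t) : 0 ≤ (imStieltjes M t).im := by
  rw [imStieltjes, ← Complex.ofReal_natCast, ← Complex.ofReal_inv, Complex.im_ofReal_mul, trace,
    Complex.im_sum]
  exact mul_nonneg (by positivity) (Finset.sum_nonneg fun i _ => hM.im_imResolvent_nonneg ht i)

theorem IsHermitian.norm_semicircleDefect_le {M : Matrix V V ℝ} (hM : M.IsHermitian) {t v : ℝ}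
    (ht : 0 < t) (hv : v ∈ Set.Icc (0 : ℝ) 1) : ‖semicircleDefect v M t‖ ≤ 2 + 1 / t ^ 2 := by
  have h := hM.norm_imStieltjes_le ht
  rw [semicircleDefect]
  refine (norm_add₃_le).trans ?_
  simp only [norm_mul, norm_pow, Complex.norm_real, Complex.norm_I, norm_one, Real.norm_eq_abs,
    abs_of_pos ht, abs_of_nonneg hv.1, mul_one]
  have h1 : t * ‖imStieltjes M t‖ ≤ 1 := by
    calc _ ≤ t * (1 / t) := by gcongr
      _ = 1 := by field_simp
  have h2 : v * ‖imStieltjes M t‖ ^ 2 ≤ 1 * (1 / t) ^ 2 := by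
    gcongr
    exact hv.2
  rw [_root_.one_div_pow] at h2
  linarith

/-- The trace moves by O(|c|), so the defect moves by O(|c|/n). This makes the defect nearly
constant when a single edge is resampled. -/
theorem IsHermitian.norm_semicircleDefect_sub_le {M N : Matrix V V ℝ} (hM : M.IsHermitian)
    (hN : N.IsHermitian) {t v : ℝ} (ht : 0 < t) (hv : v ∈ Set.Icc (0 : ℝ) 1) {i j : V} {c : ℝ}
    (h : N = M + c • (single i j (1 : ℝ) + single j i 1)) :
    ‖semicircleDefect v N t - semicircleDefect v M t‖ ≤
      (Fintype.card V : ℝ)⁻¹ * (|c| * (2 / t ^ 2)) * (t + 2 / t) := by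
  have h1 : semicircleDefect v N t - semicircleDefect v M t =
      (imStieltjes N t - imStieltjes M t) *
        ((t : ℂ) * Complex.I + (v : ℂ) * (imStieltjes N t + imStieltjes M t)) := by
    simp only [semicircleDefect]; ring
  have h2 : ‖imStieltjes N t - imStieltjes M t‖ ≤
      (Fintype.card V : ℝ)⁻¹ * (|c| * (2 / t ^ 2)) := by
    rw [imStieltjes, imStieltjes, ← mul_sub, norm_mul, norm_inv, Complex.norm_natCast]
    gcongr
    exact hM.norm_trace_imResolvent_sub_le hN ht h
  rw [h1, norm_mul]
  gcongr
  refine (norm_add_le _ _).trans ?_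
  simp only [norm_mul, Complex.norm_real, Complex.norm_I, Real.norm_eq_abs,
    abs_of_pos ht, abs_of_nonneg hv.1, mul_one]
  have h3 : v * ‖imStieltjes N t + imStieltjes M t‖ ≤ 1 * (1 / t + 1 / t) := by
    gcongr
    · exact hv.2
    · exact (norm_add_le _ _).trans
        (add_le_add (hN.norm_imStieltjes_le ht) (hM.norm_imStieltjes_le ht))
  have h4 : 1 * (1 / t + 1 / t) = 2 / t := by ring
  linarith

/-- First-order expansion of `R_ji` times the conjugate defect in the entry `(i, j)`. -/
theorem IsHermitian.norm_imResolvent_mul_defect_expansion_le {M M₀ M₁ : Matrix V V ℝ}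
    (hM : M.IsHermitian) (hM₀ : M₀.IsHermitian) (hM₁ : M₁.IsHermitian) {t v q c₀ c₁ : ℝ}
    (ht : 0 < t) (hv : v ∈ Set.Icc (0 : ℝ) 1) (hq : q ∈ Set.Icc (0 : ℝ) 1)
    (hcard : (Fintype.card V : ℝ)⁻¹ = q ^ 2) {i j : V}
    (hc₀ : |c₀| ≤ q) (hc₁ : |c₁| ≤ q)
    (h₀ : M₀ = M + c₀ • (single i j (1 : ℝ) + single j i 1))
    (h₁ : M₁ = M + c₁ • (single i j (1 : ℝ) + single j i 1))
    (h₀₁ : M₁ = M₀ + q • (single i j (1 : ℝ) + single j i 1)) :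
    ‖imResolvent M₁ t j i * star (semicircleDefect v M₁ t)
      - imResolvent M₀ t j i * star (semicircleDefect v M₀ t)
      + (q : ℂ) * ((imResolvent M t j i ^ 2 + imResolvent M t j j * imResolvent M t i i) *
        star (semicircleDefect v M t))‖ ≤
      q ^ 2 * (8 / t ^ 3 * (2 + 1 / t ^ 2) + 2 / t ^ 3 * (t + 2 / t) +
        4 / t ^ 4 * (t + 2 / t)) := by
  obtain ⟨hq0, hq1⟩ := hq
  set R := imResolvent M t with hR
  set R₀ := imResolvent M₀ t with hR₀
  set R₁ := imResolvent M₁ t with hR₁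
  set F := semicircleDefect v M t with hF
  set F₀ := semicircleDefect v M₀ t with hF₀
  set F₁ := semicircleDefect v M₁ t with hF₁
  set W : ℂ := R j i ^ 2 + R j j * R i i with hW
  have bR (a b) : ‖R a b‖ ≤ 1 / t := hM.norm_imResolvent_le ht a b
  have bR₀ (a b) : ‖R₀ a b‖ ≤ 1 / t := hM₀.norm_imResolvent_le ht a b
  have bR₁ (a b) : ‖R₁ a b‖ ≤ 1 / t := hM₁.norm_imResolvent_le ht a b
  have d₀ (a b) : ‖R₀ a b - R a b‖ ≤ q * (2 / t ^ 2) :=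
    (hM.norm_imResolvent_sub_le hM₀ ht h₀ a b).trans (by gcongr)
  have d₁ (a b) : ‖R₁ a b - R a b‖ ≤ q * (2 / t ^ 2) :=
    (hM.norm_imResolvent_sub_le hM₁ ht h₁ a b).trans (by gcongr)
  have prod (a b c d) : ‖R₁ a b * R₀ c d - R a b * R c d‖ ≤ q * (4 / t ^ 3) := by
    have : R₁ a b * R₀ c d - R a b * R c d =
        R₁ a b * (R₀ c d - R c d) + (R₁ a b - R a b) * R c d := by ring
    rw [this]
    refine (norm_add_le _ _).trans ?_
    rw [norm_mul, norm_mul]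
    calc _ ≤ 1 / t * (q * (2 / t ^ 2)) + q * (2 / t ^ 2) * (1 / t) := by
          gcongr
          · exact bR₁ _ _
          · exact d₀ _ _
          · exact d₁ _ _
          · exact bR _ _
      _ = _ := by field_simp; ring
  have e1 : ‖R₁ j i - R₀ j i + (q : ℂ) * W‖ ≤ q ^ 2 * (8 / t ^ 3) := by
    rw [hM₀.imResolvent_sub_apply hM₁ ht.ne' h₀₁]
    have : -(q : ℂ) * (R₁ j i * R₀ j i + R₁ j j * R₀ i i) + (q : ℂ) * W =
        -(q : ℂ) * ((R₁ j i * R₀ j i - R j i * R j i) + (R₁ j j * R₀ i i - R j j * R i i)) := by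
      rw [hW]; ring
    rw [← hR₀, ← hR₁, this, norm_mul, norm_neg, Complex.norm_real, Real.norm_eq_abs,
      abs_of_nonneg hq0]
    calc _ ≤ q * (q * (4 / t ^ 3) + q * (4 / t ^ 3)) := by
          gcongr
          exact (norm_add_le _ _).trans (add_le_add (prod _ _ _ _) (prod _ _ _ _))
      _ = _ := by ring
  have bW : ‖W‖ ≤ 2 / t ^ 2 := by
    refine (norm_add_le _ _).trans ?_
    rw [norm_pow, norm_mul]
    calc _ ≤ (1 / t) ^ 2 + 1 / t * (1 / t) := by
          gcongr
          · exact bR _ _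
          · exact bR _ _
          · exact bR _ _
      _ = _ := by field_simp; norm_num
  have bF₁ : ‖star F₁‖ ≤ 2 + 1 / t ^ 2 := by
    rw [norm_star]; exact hM₁.norm_semicircleDefect_le ht hv
  -- The true size is q³, from n⁻¹ = q² and a perturbation of size q; order q² is all that is
  -- needed.
  have dF₀₁ : ‖star F₁ - star F₀‖ ≤ q ^ 2 * (2 / t ^ 2) * (t + 2 / t) := by
    rw [← star_sub, norm_star]
    refine (hM₀.norm_semicircleDefect_sub_le hM₁ ht hv h₀₁).trans ?_
    rw [hcard, abs_of_nonneg hq0]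
    gcongr
    nlinarith [show 0 ≤ 2 / t ^ 2 by positivity]
  have dF : ‖star F - star F₁‖ ≤ q * (2 / t ^ 2) * (t + 2 / t) := by
    rw [← star_sub, norm_star, norm_sub_rev]
    refine (hM.norm_semicircleDefect_sub_le hM₁ ht hv h₁).trans ?_
    rw [hcard]
    refine mul_le_mul_of_nonneg_right ?_ (by positivity)
    calc q ^ 2 * (|c₁| * (2 / t ^ 2)) ≤ 1 * (q * (2 / t ^ 2)) := by
          gcongr
          exact pow_le_one₀ hq0 hq1
      _ = _ := one_mul _
  have key : R₁ j i * star F₁ - R₀ j i * star F₀ + (q : ℂ) * (W * star F) =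
      (R₁ j i - R₀ j i + (q : ℂ) * W) * star F₁ + R₀ j i * (star F₁ - star F₀) +
        (q : ℂ) * (W * (star F - star F₁)) := by ring
  rw [key]
  refine (norm_add₃_le).trans ?_
  simp only [norm_mul, Complex.norm_real, Real.norm_eq_abs, abs_of_nonneg hq0]
  calc _ ≤ q ^ 2 * (8 / t ^ 3) * (2 + 1 / t ^ 2) + 1 / t * (q ^ 2 * (2 / t ^ 2) * (t + 2 / t)) +
        q * (2 / t ^ 2 * (q * (2 / t ^ 2) * (t + 2 / t))) := by
        gcongr
        exact bR₀ _ _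
    _ = _ := by ring

/-- This is the trace of MR = 1 + itR, the source of the linear part of the defect. -/
theorem IsHermitian.sum_mul_imResolvent {M : Matrix V V ℝ} (hM : M.IsHermitian) {t : ℝ}
    (ht : t ≠ 0) : ∑ i, ∑ j, (M i j : ℂ) * imResolvent M t j i =
      Fintype.card V + ((t : ℂ) * Complex.I) * (imResolvent M t).trace := by
  have h := congrArg trace (hM.mul_imResolvent ht)
  rw [sub_mul, trace_sub, smul_mul_assoc, one_mul, trace_smul, trace_one, smul_eq_mul,
    sub_eq_iff_eq_add] at h
  rw [← h, trace]
  simp [mul_apply]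

/-- The products R_jj R_ii rebuild the squared trace. The squares R_ji² sum to O(n) by the Ward
identity, and the omitted diagonal is O(n) as well, against a squared trace that may be of order n².
-/
theorem IsHermitian.norm_sum_imResolvent_sq_add_sub_le {M : Matrix V V ℝ} (hM : M.IsHermitian)
    {t : ℝ} (ht : 0 < t) :
    ‖(∑ i, ∑ j, if i = j then 0 else
        (imResolvent M t j i ^ 2 + imResolvent M t j j * imResolvent M t i i))
      - (imResolvent M t).trace ^ 2‖ ≤ Fintype.card V * (3 / t ^ 2) := by
  set R := imResolvent M t with hR
  have h1 : (∑ i, ∑ j, if i = j then 0 else (R j i ^ 2 + R j j * R i i)) - R.trace ^ 2 =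
      ∑ i, (∑ j, R i j ^ 2 - 2 * R i i ^ 2) := by
    have h2 : R.trace ^ 2 = ∑ i, ∑ j, R j j * R i i := by
      rw [sq, trace, Finset.sum_mul_sum, Finset.sum_comm]
      rfl
    rw [h2, ← Finset.sum_sub_distrib]
    refine Finset.sum_congr rfl fun i _ => ?_
    rw [← Finset.sum_sub_distrib, ← Finset.add_sum_erase _ _ (Finset.mem_univ i),
      ← Finset.add_sum_erase (a := i) Finset.univ (fun j => R i j ^ 2) (Finset.mem_univ i)]
    have h3 : ∑ j ∈ Finset.univ.erase i,
        ((if i = j then 0 else (R j i ^ 2 + R j j * R i i)) - R j j * R i i) =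
        ∑ j ∈ Finset.univ.erase i, R i j ^ 2 := by
      refine Finset.sum_congr rfl fun j hj => ?_
      rw [if_neg (Finset.ne_of_mem_erase hj).symm, show R i j = R j i from hM.imResolvent_apply_comm t i j]
      ring
    rw [h3, if_pos rfl]
    ring
  rw [h1]
  refine (norm_sum_le _ _).trans ?_
  have h4 (i : V) : ‖∑ j, R i j ^ 2 - 2 * R i i ^ 2‖ ≤ 3 / t ^ 2 := by
    refine (norm_sub_le _ _).trans ?_
    have h5 : ‖∑ j, R i j ^ 2‖ ≤ 1 / t ^ 2 := by
      refine (norm_sum_le _ _).trans ?_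
      simp only [norm_pow]
      exact hM.sum_norm_sq_imResolvent_le ht i
    have h6 : ‖(2 : ℂ) * R i i ^ 2‖ ≤ 2 * (1 / t) ^ 2 := by
      rw [norm_mul, norm_pow, Complex.norm_ofNat]
      gcongr
      exact hM.norm_imResolvent_diag_le ht i
    rw [_root_.one_div_pow] at h6
    calc _ ≤ 1 / t ^ 2 + 2 * (1 / t ^ 2) := add_le_add h5 h6
      _ = _ := by ring
  refine (Finset.sum_le_sum fun i _ => h4 i).trans ?_
  simp

end Matrix

/-! ### The second moment of the defect for the scaled adjacency matrix. -/

namespace SimpleGraph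

open Matrix

variable {V : Type*} [Fintype V] [DecidableEq V]

/-- The centred adjacency matrix, scaled by `1 / √n`. -/
noncomputable def scaledAdj (p : ℝ) (G : SimpleGraph V) : Matrix V V ℝ :=
  (Real.sqrt (Fintype.card V))⁻¹ • centeredAdj p G

omit [DecidableEq V] in
theorem scaledAdj_isHermitian (p : ℝ) (G : SimpleGraph V) : (scaledAdj p G).IsHermitian := by
  refine IsHermitian.ext fun i j => ?_
  simp [scaledAdj, centeredAdj_symm p G i j]

omit [DecidableEq V] in
theorem inv_sqrt_card_mem_Icc : (Real.sqrt (Fintype.card V))⁻¹ ∈ Set.Icc (0 : ℝ) 1 := by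
  refine ⟨by positivity, ?_⟩
  rcases Nat.eq_zero_or_pos (Fintype.card V) with h | h
  · simp [h]
  · refine inv_le_one_of_one_le₀ (Real.one_le_sqrt.2 ?_)
    exact_mod_cast h

omit [DecidableEq V] in
theorem inv_card_eq_inv_sqrt_sq :
    ((Fintype.card V : ℝ))⁻¹ = (Real.sqrt (Fintype.card V))⁻¹ ^ 2 := by
  rw [inv_pow, Real.sq_sqrt (Nat.cast_nonneg _)]

theorem norm_scaledAdj_expansion_le {p : ℝ} (G : SimpleGraph V) {t v : ℝ} (ht : 0 < t)
    (hv : v ∈ Set.Icc (0 : ℝ) 1) {i j : V} (hij : i ≠ j) :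
    ‖imResolvent (scaledAdj p (G ⊔ edge i j)) t j i *
          star (semicircleDefect v (scaledAdj p (G ⊔ edge i j)) t)
      - imResolvent (scaledAdj p (G \ edge i j)) t j i *
          star (semicircleDefect v (scaledAdj p (G \ edge i j)) t)
      + ((Real.sqrt (Fintype.card V))⁻¹ : ℝ) *
        ((imResolvent (scaledAdj p G) t j i ^ 2 +
          imResolvent (scaledAdj p G) t j j * imResolvent (scaledAdj p G) t i i) *
        star (semicircleDefect v (scaledAdj p G) t))‖ ≤
      (Real.sqrt (Fintype.card V))⁻¹ ^ 2 *
        (8 / t ^ 3 * (2 + 1 / t ^ 2) + 2 / t ^ 3 * (t + 2 / t) + 4 / t ^ 4 * (t + 2 / t)) := by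
  obtain ⟨c₁, hc₁, h₁⟩ := exists_centeredAdj_sup_edge p G hij
  obtain ⟨c₀, hc₀, h₀⟩ := exists_centeredAdj_sdiff_edge p G hij
  have hq := inv_sqrt_card_mem_Icc (V := V)
  set q := (Real.sqrt (Fintype.card V))⁻¹ with hqdef
  have hc (c : ℝ) (hc : |c| ≤ 1) : |q * c| ≤ q := by
    rw [abs_mul, abs_of_nonneg hq.1]
    exact mul_le_of_le_one_right hq.1 hc
  refine (scaledAdj_isHermitian p G).norm_imResolvent_mul_defect_expansion_le
    (scaledAdj_isHermitian p _) (scaledAdj_isHermitian p _) ht hv hq inv_card_eq_inv_sqrt_sq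
    (hc c₀ hc₀) (hc c₁ hc₁) ?_ ?_ ?_
  · rw [scaledAdj, h₀, smul_add, smul_smul, scaledAdj]
  · rw [scaledAdj, h₁, smul_add, smul_smul, scaledAdj]
  · rw [scaledAdj, centeredAdj_sup_edge p G hij, smul_add, smul_smul, mul_one, scaledAdj]

theorem one_add_mul_imStieltjes_scaledAdj [Nonempty V] (p : ℝ) (G : SimpleGraph V) {t : ℝ}
    (ht : t ≠ 0) :
    1 + ((t : ℂ) * Complex.I) * imStieltjes (scaledAdj p G) t =
      (Fintype.card V : ℂ)⁻¹ * ((Real.sqrt (Fintype.card V))⁻¹ : ℝ) *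
        ∑ i, ∑ j, (centeredAdj p G i j : ℂ) * imResolvent (scaledAdj p G) t j i := by
  have h := (scaledAdj_isHermitian p G).sum_mul_imResolvent ht
  have hN : (Fintype.card V : ℂ) ≠ 0 := by exact_mod_cast Fintype.card_ne_zero
  have h2 : ∑ i, ∑ j, ((scaledAdj p G i j : ℝ) : ℂ) * imResolvent (scaledAdj p G) t j i =
      ((Real.sqrt (Fintype.card V))⁻¹ : ℝ) *
        ∑ i, ∑ j, (centeredAdj p G i j : ℂ) * imResolvent (scaledAdj p G) t j i := by
    simp only [Finset.mul_sum]
    refine Finset.sum_congr rfl fun i _ => Finset.sum_congr rfl fun j _ => ?_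
    rw [← mul_assoc]
    congr 1
    simp [scaledAdj]
  rw [mul_assoc (Fintype.card V : ℂ)⁻¹, ← h2, h, imStieltjes]
  field_simp

/-- The defect in the self-consistent equation for the binomial random graph is small in `L²`. -/
theorem integral_norm_sq_semicircleDefect_le [Nonempty V] (p : unitInterval) {t : ℝ} (ht : 0 < t) :
    ∫ G, ‖semicircleDefect ((p : ℝ) * (1 - p)) (scaledAdj (V := V) p G) t‖ ^ 2
        ∂(binomialRandom V p) ≤
      (Real.sqrt (Fintype.card V))⁻¹ *
        (8 / t ^ 3 * (2 + 1 / t ^ 2) + 2 / t ^ 3 * (t + 2 / t) + 4 / t ^ 4 * (t + 2 / t) +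
          3 / t ^ 2 * (2 + 1 / t ^ 2)) := by
  set v : ℝ := (p : ℝ) * (1 - p) with hvdef
  set C : ℝ := 8 / t ^ 3 * (2 + 1 / t ^ 2) + 2 / t ^ 3 * (t + 2 / t) + 4 / t ^ 4 * (t + 2 / t)
    with hC
  set N : ℝ := (Fintype.card V : ℝ) with hN
  set q : ℝ := (Real.sqrt N)⁻¹ with hq
  set μ := binomialRandom V p with hμ
  have hv : v ∈ Set.Icc (0 : ℝ) 1 := by
    obtain ⟨h0, h1⟩ := p.2
    constructor <;> nlinarith
  obtain ⟨hq0, hq1⟩ : q ∈ Set.Icc (0 : ℝ) 1 := inv_sqrt_card_mem_Icc (V := V)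
  have hNpos : 0 < N := by rw [hN]; exact_mod_cast Fintype.card_pos
  have hNq : N⁻¹ = q ^ 2 := inv_card_eq_inv_sqrt_sq
  have hNc : (N : ℂ) = (Fintype.card V : ℂ) := by simp [hN]
  set R : SimpleGraph V → Matrix V V ℂ := fun G => imResolvent (scaledAdj p G) t with hR
  set F : SimpleGraph V → ℂ := fun G => semicircleDefect v (scaledAdj p G) t with hF
  set W : V → V → SimpleGraph V → ℂ := fun i j G => R G j i ^ 2 + R G j j * R G i i with hW
  set D : V → V → SimpleGraph V → ℂ := fun i j G =>
    R (G ⊔ edge i j) j i * star (F (G ⊔ edge i j)) - R (G \ edge i j) j i * star (F (G \ edge i j))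
      + (q : ℂ) * (W i j G * star (F G)) with hD
  have hDle (i j : V) (hij : i ≠ j) (G : SimpleGraph V) : ‖D i j G‖ ≤ q ^ 2 * C :=
    norm_scaledAdj_expansion_le G ht hv hij
  -- An exact identity. Since N⁻¹ = q², the first-order term of the integration by parts carries the
  -- coefficient v N⁻¹ q², which is also that of the squared trace in vm². They cancel, leaving the
  -- expansion remainders D and the difference between the W-sum and the squared trace.
  have hsum : ∫ G, F G * star (F G) ∂μ =
      (N⁻¹ * q * v : ℝ) * ∑ i, ∑ j, (if i = j then 0 else ∫ G, D i j G ∂μ) -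
      (v * N⁻¹ * q ^ 2 : ℝ) * ∫ G, ((∑ i, ∑ j, if i = j then 0 else W i j G) -
        (R G).trace ^ 2) * star (F G) ∂μ := by
    have hA : ∫ G, (1 + ((t : ℂ) * Complex.I) * imStieltjes (scaledAdj p G) t) * star (F G) ∂μ =
        (N⁻¹ * q * v : ℝ) * ∑ i, ∑ j, (if i = j then 0 else
          ∫ G, (R (G ⊔ edge i j) j i * star (F (G ⊔ edge i j)) -
            R (G \ edge i j) j i * star (F (G \ edge i j))) ∂μ) := by
      simp only [one_add_mul_imStieltjes_scaledAdj _ _ ht.ne']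
      simp only [mul_assoc, integral_const_mul, Finset.sum_mul]
      rw [integral_finsetSum _ (fun _ _ => .of_finite)]
      simp only [integral_finsetSum _ (fun _ _ => Integrable.of_finite)]
      push_cast
      rw [hNc]
      simp only [mul_assoc, Finset.mul_sum]
      refine Finset.sum_congr rfl fun i _ => Finset.sum_congr rfl fun j _ => ?_
      congr 2
      · simp [hq, hN]
      by_cases hij : i = j
      · subst hij
        simp [centeredAdj_self]
      · have h := integral_centeredAdj_smul p hij (fun G => R G j i * star (F G))
        rw [if_neg hij, ← Complex.real_smul, hvdef, ← h]
        simp only [Complex.real_smul]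
        rfl
    have hB : ∀ G, F G * star (F G) =
        (1 + ((t : ℂ) * Complex.I) * imStieltjes (scaledAdj p G) t) * star (F G) +
        (v * N⁻¹ * q ^ 2 : ℝ) * ((R G).trace ^ 2 * star (F G)) := by
      intro G
      have hFG : F G = 1 + ((t : ℂ) * Complex.I) * ((Fintype.card V : ℂ)⁻¹ * (R G).trace) +
          (v : ℂ) * ((Fintype.card V : ℂ)⁻¹ * (R G).trace) ^ 2 := rfl
      have hm : imStieltjes (scaledAdj p G) t = (Fintype.card V : ℂ)⁻¹ * (R G).trace := rfl
      rw [mul_assoc v, ← hNq, hm]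
      generalize star (F G) = s
      rw [hFG]
      push_cast
      rw [hNc]
      ring
    have hDint (i j : V) : ∫ G, D i j G ∂μ =
        ∫ G, (R (G ⊔ edge i j) j i * star (F (G ⊔ edge i j)) -
            R (G \ edge i j) j i * star (F (G \ edge i j))) ∂μ +
          (q : ℂ) * ∫ G, W i j G * star (F G) ∂μ := by
      rw [hD, ← integral_const_mul, ← integral_add .of_finite .of_finite]
    have hWint : ∫ G, ((∑ i, ∑ j, if i = j then 0 else W i j G) -
        (R G).trace ^ 2) * star (F G) ∂μ =
        ∑ i, ∑ j, (if i = j then 0 else ∫ G, W i j G * star (F G) ∂μ) -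
        ∫ G, (R G).trace ^ 2 * star (F G) ∂μ := by
      simp only [sub_mul]
      rw [integral_sub .of_finite .of_finite]
      congr 1
      simp only [Finset.sum_mul]
      rw [integral_finsetSum _ (fun _ _ => .of_finite)]
      simp only [integral_finsetSum _ (fun _ _ => Integrable.of_finite)]
      refine Finset.sum_congr rfl fun i _ => Finset.sum_congr rfl fun j _ => ?_
      by_cases hij : i = j <;> simp [hij]
    have hDsum : ∑ i, ∑ j, (if i = j then 0 else ∫ G, D i j G ∂μ) =
        ∑ i, ∑ j, (if i = j then 0 else
          ∫ G, (R (G ⊔ edge i j) j i * star (F (G ⊔ edge i j)) -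
            R (G \ edge i j) j i * star (F (G \ edge i j))) ∂μ) +
        (q : ℂ) * ∑ i, ∑ j, (if i = j then 0 else ∫ G, W i j G * star (F G) ∂μ) := by
      simp only [Finset.mul_sum, ← Finset.sum_add_distrib]
      refine Finset.sum_congr rfl fun i _ => Finset.sum_congr rfl fun j _ => ?_
      by_cases hij : i = j
      · simp [hij]
      · simp only [if_neg hij, hDint]
    simp only [hB]
    rw [integral_add .of_finite .of_finite, integral_const_mul, hA, hWint, hDsum]
    push_cast
    ring
  have hreal : ((∫ G, ‖F G‖ ^ 2 ∂μ : ℝ) : ℂ) = ∫ G, F G * star (F G) ∂μ := by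
    rw [← integral_complex_ofReal]
    congr 1 with G
    push_cast
    exact (Complex.mul_conj' _).symm
  have hnorm : ∫ G, ‖F G‖ ^ 2 ∂μ = ‖∫ G, F G * star (F G) ∂μ‖ := by
    rw [← hreal, Complex.norm_real, Real.norm_of_nonneg (integral_nonneg fun G => sq_nonneg _)]
  have b1 : ‖∑ i, ∑ j, (if i = j then 0 else ∫ G, D i j G ∂μ)‖ ≤ N * (N * (q ^ 2 * C)) := by
    have hC0 : 0 ≤ q ^ 2 * C := by positivity
    have h (i j : V) : ‖(if i = j then 0 else ∫ G, D i j G ∂μ)‖ ≤ q ^ 2 * C := by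
      by_cases hij : i = j
      · simp [hij, hC0]
      · rw [if_neg hij]
        refine (norm_integral_le_of_norm_le_const (C := q ^ 2 * C)
          (Eventually.of_forall fun G => hDle i j hij G)).trans ?_
        simp
    have h2 (i : V) : ‖∑ j, (if i = j then 0 else ∫ G, D i j G ∂μ)‖ ≤ N * (q ^ 2 * C) := by
      refine (norm_sum_le _ _).trans ((Finset.sum_le_sum fun j _ => h i j).trans ?_)
      simp [hN]
    refine (norm_sum_le _ _).trans ((Finset.sum_le_sum fun i _ => h2 i).trans ?_)
    simp [hN]
  have b2 : ‖∫ G, ((∑ i, ∑ j, if i = j then 0 else W i j G) -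
        (R G).trace ^ 2) * star (F G) ∂μ‖ ≤ N * (3 / t ^ 2) * (2 + 1 / t ^ 2) := by
    refine (norm_integral_le_of_norm_le_const (C := N * (3 / t ^ 2) * (2 + 1 / t ^ 2))
      (Eventually.of_forall fun G => ?_)).trans (by simp)
    rw [norm_mul, norm_star]
    gcongr
    · exact (scaledAdj_isHermitian (p : ℝ) G).norm_sum_imResolvent_sq_add_sub_le ht
    · exact (scaledAdj_isHermitian (p : ℝ) G).norm_semicircleDefect_le ht hv
  rw [hnorm, hsum]
  refine (norm_sub_le _ _).trans ?_
  rw [norm_mul, norm_mul, Complex.norm_real, Complex.norm_real, Real.norm_eq_abs, Real.norm_eq_abs,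
    abs_of_nonneg (mul_nonneg (by positivity) hv.1),
    abs_of_nonneg (mul_nonneg (mul_nonneg hv.1 (by positivity)) (by positivity))]
  have hC0 : 0 ≤ C := by positivity
  have hNqq : N * q ^ 2 = 1 := by rw [← hNq]; exact mul_inv_cancel₀ hNpos.ne'
  -- The N² remainders of size q²C, weighted by N⁻¹q, total qC because Nq² = 1; the trace correction
  -- is of order q².
  calc _ ≤ N⁻¹ * q * 1 * (N * (N * (q ^ 2 * C))) +
        1 * N⁻¹ * q ^ 2 * (N * (3 / t ^ 2) * (2 + 1 / t ^ 2)) := by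
        gcongr
        · exact hv.2
        · exact hv.2
    _ = q * C + q * (q * (3 / t ^ 2 * (2 + 1 / t ^ 2))) := by
        have h1 : N⁻¹ * q * 1 * (N * (N * (q ^ 2 * C))) = (N⁻¹ * N) * (N * q ^ 2) * (q * C) := by
          ring
        have h2 : 1 * N⁻¹ * q ^ 2 * (N * (3 / t ^ 2) * (2 + 1 / t ^ 2)) =
          (N⁻¹ * N) * (q * (q * (3 / t ^ 2 * (2 + 1 / t ^ 2)))) := by ring
        rw [h1, h2, inv_mul_cancel₀ hNpos.ne', hNqq]
        ring
    _ ≤ q * (C + 3 / t ^ 2 * (2 + 1 / t ^ 2)) := by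
        rw [mul_add q C]
        exact add_le_add_right (mul_le_mul_of_nonneg_left
          (mul_le_of_le_one_left (by positivity) hq1) hq0) _

end SimpleGraph

/-! ### The semicircle law on the imaginary axis. -/

/-- The Stieltjes transform of the semicircle law of variance `v` at `i t`, divided by `i`. -/
noncomputable def semicircleStieltjes (v t : ℝ) : ℝ := (Real.sqrt (t ^ 2 + 4 * v) - t) / (2 * v)

section

variable {v : ℝ}

/-- This is the equation 1 + itm + vm² = 0 at m = is. -/
theorem semicircleStieltjes_quadratic (hv : 0 < v) (t : ℝ) :
    v * semicircleStieltjes v t ^ 2 = 1 - t * semicircleStieltjes v t := by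
  have h : Real.sqrt (t ^ 2 + 4 * v) ^ 2 = t ^ 2 + 4 * v := Real.sq_sqrt (by positivity)
  rw [semicircleStieltjes]
  set u := Real.sqrt (t ^ 2 + 4 * v)
  field_simp
  linear_combination h

theorem semicircleStieltjes_pos (hv : 0 < v) (t : ℝ) : 0 < semicircleStieltjes v t := by
  apply div_pos _ (by positivity)
  rw [sub_pos]
  apply Real.lt_sqrt_of_sq_lt
  linarith

theorem mul_semicircleStieltjes_le_one (hv : 0 < v) (t : ℝ) :
    t * semicircleStieltjes v t ≤ 1 := by
  have h := semicircleStieltjes_quadratic hv t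
  nlinarith [sq_nonneg (semicircleStieltjes v t)]

/-- Add the two bounds vs² = 1 - ts ≤ 1 and t²·vs² = v(ts)² ≤ 1. The result dominates the limit
function in t. -/
theorem semicircleStieltjes_sq_le (hv : v ∈ Set.Ioc (0 : ℝ) 1) {t : ℝ} (ht : 0 ≤ t) :
    v * semicircleStieltjes v t ^ 2 ≤ 2 * (1 + t ^ 2)⁻¹ := by
  obtain ⟨h0, h1⟩ := hv
  have hs := semicircleStieltjes_pos h0 t
  have hq := semicircleStieltjes_quadratic h0 t
  have hl := mul_semicircleStieltjes_le_one h0 t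
  set s := semicircleStieltjes v t
  have hts : 0 ≤ t * s := by positivity
  rw [← div_eq_mul_inv, le_div_iff₀ (by positivity)]
  have h2 : (t * s) ^ 2 ≤ 1 := pow_le_one₀ hts hl
  nlinarith

theorem continuous_semicircleStieltjes (v : ℝ) : Continuous (semicircleStieltjes v) := by
  unfold semicircleStieltjes
  fun_prop

theorem hasDerivAt_semicircleStieltjes (hv : 0 < v) (t : ℝ) :
    HasDerivAt (semicircleStieltjes v)
      (-(semicircleStieltjes v t / Real.sqrt (t ^ 2 + 4 * v))) t := by
  have hpos : 0 < t ^ 2 + 4 * v := by positivity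
  have hu := Real.sqrt_pos.2 hpos
  have h1 : HasDerivAt (fun t : ℝ => t ^ 2 + 4 * v) (2 * t) t := by
    simpa using (hasDerivAt_pow 2 t).add_const (4 * v)
  have h2 := ((h1.sqrt hpos.ne').sub (hasDerivAt_id t)).div_const (2 * v)
  refine h2.congr_deriv ?_
  rw [semicircleStieltjes]
  field_simp
  ring

theorem tendsto_semicircleStieltjes_atTop (hv : 0 < v) :
    Tendsto (semicircleStieltjes v) atTop (𝓝 0) := by
  refine tendsto_of_tendsto_of_tendsto_of_le_of_le' tendsto_const_nhds tendsto_inv_atTop_zero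
    (Eventually.of_forall fun t => (semicircleStieltjes_pos hv t).le) ?_
  filter_upwards [eventually_gt_atTop 0] with t ht
  rw [← one_div, le_div_iff₀ ht, mul_comm]
  exact mul_semicircleStieltjes_le_one hv t

theorem integral_semicircleStieltjes_sq (hv : 0 < v) :
    ∫ t in Set.Ioi (0 : ℝ), v * semicircleStieltjes v t ^ 2 = 4 / 3 * Real.sqrt v := by
  set s := semicircleStieltjes v with hs
  -- The antiderivative comes from the substitution t = 1/s - vs, under which vs² dt = -(v + v²s²)
  -- ds. As s falls from v^(-1/2) to 0, the integral is √v + √v/3.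
  have hderiv (t : ℝ) : HasDerivAt (fun t => -(v * s t + v ^ 2 / 3 * s t ^ 3)) (v * s t ^ 2) t := by
    have h := hasDerivAt_semicircleStieltjes hv t
    have h1 := ((h.const_mul v).add ((h.pow 3).const_mul (v ^ 2 / 3))).neg
    refine h1.congr_deriv ?_
    have hu : 0 < Real.sqrt (t ^ 2 + 4 * v) := Real.sqrt_pos.2 (by positivity)
    have hq := semicircleStieltjes_quadratic hv t
    have hsu : Real.sqrt (t ^ 2 + 4 * v) = 2 * v * s t + t := by
      rw [hs, semicircleStieltjes]; field_simp; ring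
    rw [← hs] at hq ⊢
    have e : s t / Real.sqrt (t ^ 2 + 4 * v) * (1 + v * s t ^ 2) = s t ^ 2 := by
      rw [div_mul_eq_mul_div, div_eq_iff hu.ne', hsu]
      linear_combination (- s t) * hq
    push_cast
    linear_combination v * e
  have hlim : Tendsto (fun t => -(v * s t + v ^ 2 / 3 * s t ^ 3)) atTop (𝓝 0) := by
    have h := tendsto_semicircleStieltjes_atTop hv
    have := ((h.const_mul v).add ((h.pow 3).const_mul (v ^ 2 / 3))).neg
    simpa using this
  rw [integral_Ioi_of_hasDerivAt_of_nonneg' (fun t _ => hderiv t)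
    (fun t _ => by positivity) hlim]
  have h0 : s 0 = (Real.sqrt v)⁻¹ := by
    rw [hs, semicircleStieltjes]
    have : (0 : ℝ) ^ 2 + 4 * v = 2 ^ 2 * v := by ring
    rw [this, Real.sqrt_mul (by positivity), Real.sqrt_sq (by norm_num)]
    have hv' := Real.sqrt_pos.2 hv
    field_simp
    linear_combination 2 * Real.sq_sqrt hv.le
  rw [h0]
  have hv' := Real.sqrt_pos.2 hv
  have hvv := Real.sq_sqrt hv.le
  set r := Real.sqrt v
  rw [← hvv]
  field_simp
  ring

end

/-! ### Absolute values as integrals, and stability of the semicircle equation. -/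

theorem sq_div_sq_add_sq_le (x t : ℝ) : x ^ 2 / (x ^ 2 + t ^ 2) ≤ (1 + x ^ 2) * (1 + t ^ 2)⁻¹ := by
  rcases (add_nonneg (sq_nonneg x) (sq_nonneg t)).eq_or_lt with h | h
  · rw [← h, div_zero]; positivity
  · rw [← div_eq_mul_inv, div_le_div_iff₀ h (by positivity)]
    nlinarith [sq_nonneg x, sq_nonneg t, mul_nonneg (sq_nonneg x) (sq_nonneg x)]

theorem measurable_sq_div_sq_add_sq (x : ℝ) :
    Measurable (fun t : ℝ => x ^ 2 / (x ^ 2 + t ^ 2)) := by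
  fun_prop

theorem integrable_sq_div_sq_add_sq (x : ℝ) :
    Integrable (fun t : ℝ => x ^ 2 / (x ^ 2 + t ^ 2)) := by
  refine (integrable_inv_one_add_sq.const_mul (1 + x ^ 2)).mono'
    (measurable_sq_div_sq_add_sq x).aestronglyMeasurable (Eventually.of_forall fun t => ?_)
  rw [Real.norm_of_nonneg (by positivity)]
  exact sq_div_sq_add_sq_le x t

/-- An integral representation of the absolute value. -/
theorem integral_Ioi_sq_div_sq_add_sq (x : ℝ) :
    ∫ t in Set.Ioi (0 : ℝ), x ^ 2 / (x ^ 2 + t ^ 2) = Real.pi / 2 * |x| := by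
  rcases eq_or_ne x 0 with rfl | hx
  · simp
  · have hx' : 0 < |x| := abs_pos.2 hx
    have h1 (t : ℝ) : x ^ 2 / (x ^ 2 + t ^ 2) = (1 + (|x|⁻¹ * t) ^ 2)⁻¹ := by
      rw [mul_pow, inv_pow, sq_abs]
      field_simp
    simp only [h1]
    rw [integral_comp_mul_left_Ioi (fun t => (1 + t ^ 2)⁻¹) 0 (inv_pos.2 hx'), mul_zero,
      integral_Ioi_inv_one_add_sq]
    simp [mul_comm]

namespace Matrix

variable {V : Type*} [Fintype V] [DecidableEq V]

theorem IsHermitian.sum_eigenvalues_sq {M : Matrix V V ℝ} (hM : M.IsHermitian) :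
    ∑ k, hM.eigenvalues k ^ 2 = ∑ i, ∑ j, M i j ^ 2 := by
  have h1 : (M * M).trace = ∑ i, ∑ j, M i j ^ 2 := by
    refine Finset.sum_congr rfl fun i _ => ?_
    rw [diag_apply, mul_apply]
    refine Finset.sum_congr rfl fun j _ => ?_
    rw [sq, ← hM.apply j i]
    rfl
  set U := (hM.eigenvectorUnitary : Matrix V V ℝ) with hU
  have hUU : Uᵀ * U = 1 := Unitary.coe_star_mul_self hM.eigenvectorUnitary
  have h2 : M * M = U * (diagonal hM.eigenvalues * diagonal hM.eigenvalues) * Uᵀ := by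
    conv_lhs => rw [hM.eq_mul_diagonal_mul_transpose]
    rw [← hU]
    calc _ = U * (diagonal hM.eigenvalues * (Uᵀ * U) * diagonal hM.eigenvalues) * Uᵀ := by
          simp only [mul_assoc]
      _ = _ := by rw [hUU, mul_one]
  rw [← h1, h2, trace_mul_comm, ← mul_assoc, hUU, one_mul, diagonal_mul_diagonal, trace_diagonal]
  simp [sq]

theorem IsHermitian.inv_card_mul_sum_sq_div [Nonempty V] {M : Matrix V V ℝ} (hM : M.IsHermitian)
    {t : ℝ} (ht : 0 < t) :
    (Fintype.card V : ℝ)⁻¹ * ∑ k, hM.eigenvalues k ^ 2 / (hM.eigenvalues k ^ 2 + t ^ 2) =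
      1 - t * (imStieltjes M t).im := by
  have hN : (Fintype.card V : ℝ) ≠ 0 := by exact_mod_cast Fintype.card_ne_zero
  have h1 (x : ℝ) : (((x : ℂ) - (t : ℂ) * Complex.I)⁻¹).im = t / (x ^ 2 + t ^ 2) := by
    rw [Complex.inv_im, Complex.normSq_apply]
    simp [sq]
  have h2 : (imStieltjes M t).im =
      (Fintype.card V : ℝ)⁻¹ * ∑ k, t / (hM.eigenvalues k ^ 2 + t ^ 2) := by
    rw [imStieltjes, ← Complex.ofReal_natCast, ← Complex.ofReal_inv, Complex.im_ofReal_mul,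
      hM.trace_imResolvent ht.ne', Complex.im_sum]
    simp only [h1]
  have h3 (x : ℝ) : x ^ 2 / (x ^ 2 + t ^ 2) = 1 - t * (t / (x ^ 2 + t ^ 2)) := by
    have : x ^ 2 + t ^ 2 ≠ 0 := by positivity
    field_simp
    ring
  rw [h2]
  simp only [h3, Finset.sum_sub_distrib, ← Finset.mul_sum]
  simp only [Finset.sum_const, Finset.card_univ, nsmul_eq_mul, mul_one]
  rw [mul_sub, inv_mul_cancel₀ hN]
  ring

/-- Each summand is at most (1 + λ²)/(1 + t²), and the Frobenius bound makes the average of λ² at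
most 1. The majorant is independent of n and integrable in t. -/
theorem IsHermitian.inv_card_mul_sum_sq_div_le {M : Matrix V V ℝ} (hM : M.IsHermitian)
    (hM2 : ∑ i, ∑ j, M i j ^ 2 ≤ Fintype.card V) (t : ℝ) :
    (Fintype.card V : ℝ)⁻¹ * ∑ k, hM.eigenvalues k ^ 2 / (hM.eigenvalues k ^ 2 + t ^ 2) ≤
      2 * (1 + t ^ 2)⁻¹ := by
  rw [← hM.sum_eigenvalues_sq] at hM2
  have h1 : ∑ k, hM.eigenvalues k ^ 2 / (hM.eigenvalues k ^ 2 + t ^ 2) ≤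
      Fintype.card V * (2 * (1 + t ^ 2)⁻¹) := by
    refine (Finset.sum_le_sum fun k _ => sq_div_sq_add_sq_le _ t).trans ?_
    rw [← Finset.sum_mul, ← mul_assoc]
    gcongr
    rw [Finset.sum_add_distrib]
    simp only [Finset.sum_const, Finset.card_univ, nsmul_eq_mul, mul_one]
    linarith
  rcases (Nat.cast_nonneg (α := ℝ) (Fintype.card V)).eq_or_lt with h0 | h0
  · rw [← h0, _root_.inv_zero, zero_mul]; positivity
  · rwa [inv_mul_le_iff₀ h0]

/-- A small defect in the self-consistent equation forces the spectral statistic close to its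
semicircle value. -/
theorem IsHermitian.abs_sub_semicircle_le [Nonempty V] {M : Matrix V V ℝ} (hM : M.IsHermitian)
    {t v : ℝ} (ht : 0 < t) (hv : 0 < v) :
    |(Fintype.card V : ℝ)⁻¹ * ∑ k, hM.eigenvalues k ^ 2 / (hM.eigenvalues k ^ 2 + t ^ 2) -
      v * semicircleStieltjes v t ^ 2| ≤ ‖semicircleDefect v M t‖ := by
  rw [hM.inv_card_mul_sum_sq_div ht, semicircleStieltjes_quadratic hv]
  set m := imStieltjes M t with hm
  set s := semicircleStieltjes v t with hs
  have hm0 : 0 ≤ m.im := hM.im_imStieltjes_nonneg ht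
  have hs0 : 0 < s := semicircleStieltjes_pos hv t
  have hq : v * s ^ 2 = 1 - t * s := semicircleStieltjes_quadratic hv t
  have hF : semicircleDefect v M t =
      (m - (s : ℂ) * Complex.I) * ((v : ℂ) * m + ((v * s + t : ℝ) : ℂ) * Complex.I) := by
    rw [semicircleDefect, ← hm]
    have hqc : (v : ℂ) * (s : ℂ) ^ 2 = 1 - t * s := by exact_mod_cast hq
    push_cast
    linear_combination -hqc + (v * (s : ℂ) ^ 2 + t * s) * Complex.I_sq
  -- The imaginary part of this factor is v·Im m + vs + t, and both Im m and s are nonnegative.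
  -- Dividing by it costs 1/t, which cancels the t in the difference t(s - Im m) being estimated.
  have h1 : t ≤ ‖(v : ℂ) * m + ((v * s + t : ℝ) : ℂ) * Complex.I‖ := by
    refine le_trans ?_ ((le_abs_self _).trans (Complex.abs_im_le_norm _))
    simp only [Complex.add_im, Complex.im_ofReal_mul, Complex.I_im, mul_one]
    have := mul_nonneg hv.le hm0
    have := mul_pos hv hs0
    linarith
  have h2 : |m.im - s| ≤ ‖m - (s : ℂ) * Complex.I‖ := by
    refine le_trans (le_of_eq ?_) (Complex.abs_im_le_norm _)
    simp
  rw [hF, norm_mul]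
  calc _ = |m.im - s| * t := by
        rw [← abs_of_pos ht, ← abs_mul, ← abs_neg, abs_of_pos ht]
        congr 1
        ring
    _ ≤ _ := by gcongr

end Matrix

/-! ### Convergence of the normalized adjacency energy. -/

namespace SimpleGraph

open Matrix

section

variable {V : Type*} [Fintype V] [DecidableEq V]

omit [DecidableEq V] in
theorem sum_scaledAdj_sq_le (p : unitInterval) (G : SimpleGraph V) :
    ∑ i, ∑ j, scaledAdj p G i j ^ 2 ≤ Fintype.card V := by
  have h (i j : V) : scaledAdj p G i j ^ 2 ≤ (Fintype.card V : ℝ)⁻¹ := by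
    rw [scaledAdj, Matrix.smul_apply, smul_eq_mul, mul_pow, ← inv_card_eq_inv_sqrt_sq]
    refine mul_le_of_le_one_right (by positivity) ?_
    rw [sq_le_one_iff_abs_le_one]
    exact abs_centeredAdj_le p.2 G i j
  refine (Finset.sum_le_sum fun i _ => Finset.sum_le_sum fun j _ => h i j).trans ?_
  simp only [Finset.sum_const, Finset.card_univ, nsmul_eq_mul]
  rcases (Nat.cast_nonneg (α := ℝ) (Fintype.card V)).eq_or_lt with h0 | h0
  · rw [← h0]; simp
  · rw [mul_inv_cancel₀ h0.ne', mul_one]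

/-- The smoothed spectral statistic `n⁻¹ ∑ λ² / (λ² + t²)` of the scaled adjacency matrix. -/
noncomputable def smoothedEnergy (p t : ℝ) (G : SimpleGraph V) : ℝ :=
  (Fintype.card V : ℝ)⁻¹ * ∑ k, (scaledAdj_isHermitian p G).eigenvalues k ^ 2 /
    ((scaledAdj_isHermitian p G).eigenvalues k ^ 2 + t ^ 2)

theorem smoothedEnergy_nonneg (p t : ℝ) (G : SimpleGraph V) : 0 ≤ smoothedEnergy p t G := by
  unfold smoothedEnergy
  positivity

theorem smoothedEnergy_le (p : unitInterval) (t : ℝ) (G : SimpleGraph V) :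
    smoothedEnergy p t G ≤ 2 * (1 + t ^ 2)⁻¹ :=
  (scaledAdj_isHermitian (p : ℝ) G).inv_card_mul_sum_sq_div_le (sum_scaledAdj_sq_le p G) t

theorem integrable_smoothedEnergy (p : ℝ) (G : SimpleGraph V) :
    Integrable (fun t => smoothedEnergy p t G) :=
  (integrable_finsetSum _ fun _ _ => integrable_sq_div_sq_add_sq _).const_mul _

theorem inv_card_mul_energy_eq_integral (p : ℝ) (G : SimpleGraph V) :
    (Fintype.card V : ℝ)⁻¹ * matrixEnergy (scaledAdj p G) (scaledAdj_isHermitian p G) =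
      2 / Real.pi * ∫ t in Set.Ioi (0 : ℝ), smoothedEnergy p t G := by
  unfold smoothedEnergy
  rw [integral_const_mul, integral_finsetSum _
    (fun k _ => (integrable_sq_div_sq_add_sq _).integrableOn)]
  simp only [integral_Ioi_sq_div_sq_add_sq, ← Finset.mul_sum, matrixEnergy]
  have := Real.pi_pos
  field_simp

theorem integral_abs_smoothedEnergy_sub_le [Nonempty V] (p : unitInterval) {v t : ℝ}
    (hv : v = (p : ℝ) * (1 - p)) (hv0 : 0 < v) (ht : 0 < t) :
    ∫ G, |smoothedEnergy p t G - v * semicircleStieltjes v t ^ 2| ∂(binomialRandom V p) ≤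
      Real.sqrt ((Real.sqrt (Fintype.card V))⁻¹ *
        (8 / t ^ 3 * (2 + 1 / t ^ 2) + 2 / t ^ 3 * (t + 2 / t) + 4 / t ^ 4 * (t + 2 / t) +
          3 / t ^ 2 * (2 + 1 / t ^ 2))) := by
  have h1 : ∫ G, |smoothedEnergy p t G - v * semicircleStieltjes v t ^ 2| ∂(binomialRandom V p) ≤
      ∫ G, |‖semicircleDefect v (scaledAdj (V := V) p G) t‖| ∂(binomialRandom V p) := by
    refine integral_mono .of_finite .of_finite fun G => ?_
    simp only [abs_norm]
    exact (scaledAdj_isHermitian (p : ℝ) G).abs_sub_semicircle_le ht hv0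
  refine h1.trans ((integral_abs_le_sqrt_integral_sq _ _).trans (Real.sqrt_le_sqrt ?_))
  rw [hv]
  exact integral_norm_sq_semicircleDefect_le p ht

theorem abs_smoothedEnergy_sub_le (p : unitInterval) {v t : ℝ} (hv : v ∈ Set.Ioc (0 : ℝ) 1)
    (ht : 0 ≤ t) (G : SimpleGraph V) :
    |smoothedEnergy p t G - v * semicircleStieltjes v t ^ 2| ≤ 2 * (1 + t ^ 2)⁻¹ := by
  have h1 := smoothedEnergy_nonneg (p : ℝ) t G
  have h2 := smoothedEnergy_le p t G
  have h3 := semicircleStieltjes_sq_le hv ht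
  have h4 : 0 ≤ v * semicircleStieltjes v t ^ 2 := mul_nonneg hv.1.le (sq_nonneg _)
  rw [abs_le]
  constructor <;> linarith

theorem integrableOn_semicircleStieltjes_sq {v : ℝ} (hv : v ∈ Set.Ioc (0 : ℝ) 1) :
    IntegrableOn (fun t => v * semicircleStieltjes v t ^ 2) (Set.Ioi 0) := by
  refine (integrable_inv_one_add_sq.const_mul 2).integrableOn.mono'
    (by have := continuous_semicircleStieltjes v; fun_prop) ?_
  refine (ae_restrict_mem measurableSet_Ioi).mono fun t ht => ?_
  rw [Real.norm_of_nonneg (mul_nonneg hv.1.le (sq_nonneg _))]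
  exact semicircleStieltjes_sq_le hv (le_of_lt ht)

/-- The limit constant is (2/π)·(4/3)√v, the same integral transform applied to the semicircle law.
The integrals in G and t interchange because the probability space is finite. -/
theorem integral_abs_energy_sub_le (p : unitInterval) {v : ℝ} (hv : v ∈ Set.Ioc (0 : ℝ) 1) :
    ∫ G, |(Fintype.card V : ℝ)⁻¹ * matrixEnergy (scaledAdj p G) (scaledAdj_isHermitian p G) -
      8 / (3 * Real.pi) * Real.sqrt v| ∂(binomialRandom V p) ≤
    2 / Real.pi * ∫ t in Set.Ioi (0 : ℝ),
      ∫ G, |smoothedEnergy p t G - v * semicircleStieltjes v t ^ 2| ∂(binomialRandom V p) := by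
  have hpi := Real.pi_pos
  have hint (G : SimpleGraph V) : IntegrableOn
      (fun t => |smoothedEnergy p t G - v * semicircleStieltjes v t ^ 2|) (Set.Ioi 0) :=
    ((integrable_smoothedEnergy (p : ℝ) G).integrableOn.sub
      (integrableOn_semicircleStieltjes_sq hv)).abs
  have hpt (G : SimpleGraph V) :
      |(Fintype.card V : ℝ)⁻¹ * matrixEnergy (scaledAdj p G) (scaledAdj_isHermitian p G) -
      8 / (3 * Real.pi) * Real.sqrt v| ≤ 2 / Real.pi * ∫ t in Set.Ioi (0 : ℝ),
        |smoothedEnergy p t G - v * semicircleStieltjes v t ^ 2| := by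
    have h1 : 8 / (3 * Real.pi) * Real.sqrt v =
        2 / Real.pi * ∫ t in Set.Ioi (0 : ℝ), v * semicircleStieltjes v t ^ 2 := by
      rw [integral_semicircleStieltjes_sq hv.1]
      field_simp
      ring
    rw [inv_card_mul_energy_eq_integral, h1, ← mul_sub, ← integral_sub
      (integrable_smoothedEnergy (p : ℝ) G).integrableOn (integrableOn_semicircleStieltjes_sq hv),
      abs_mul, abs_of_pos (by positivity)]
    gcongr
    exact abs_integral_le_integral_abs
  refine (integral_mono .of_finite .of_finite hpt).trans (le_of_eq ?_)
  rw [integral_const_mul]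
  congr 1
  let _ : Fintype (SimpleGraph V) := Fintype.ofFinite _
  simp only [integral_fintype (μ := binomialRandom V p) Integrable.of_finite, smul_eq_mul]
  rw [integral_finsetSum _ fun G _ => (hint G).const_mul _]
  simp only [integral_const_mul]

end

/-- The normalized energy of the scaled adjacency matrix converges in `L¹`. -/
theorem tendsto_integral_abs_energy_sub (p : unitInterval) (hp : (p : ℝ) ∈ Set.Ioo (0 : ℝ) 1) :
    Tendsto (fun n : ℕ => ∫ G, |(n : ℝ)⁻¹ *
      matrixEnergy (scaledAdj p G) (scaledAdj_isHermitian p G) -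
      8 / (3 * Real.pi) * Real.sqrt (p * (1 - p))| ∂(binomialRandom (Fin n) p)) atTop (𝓝 0) := by
  have hv : (p : ℝ) * (1 - p) ∈ Set.Ioc (0 : ℝ) 1 := by
    obtain ⟨h0, h1⟩ := hp
    exact ⟨mul_pos h0 (by linarith), by nlinarith⟩
  set v := (p : ℝ) * (1 - p) with hvdef
  set φ : ℕ → ℝ → ℝ := fun n t =>
    ∫ G, |smoothedEnergy p t G - v * semicircleStieltjes v t ^ 2| ∂(binomialRandom (Fin n) p)
    with hφ
  have hφ0 (n : ℕ) (t : ℝ) : 0 ≤ φ n t := integral_nonneg fun G => abs_nonneg _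
  have hlim : Tendsto (fun n => ∫ t in Set.Ioi (0 : ℝ), φ n t) atTop (𝓝 0) := by
    have h := tendsto_integral_of_dominated_convergence (μ := volume.restrict (Set.Ioi (0 : ℝ)))
      (F := φ) (f := fun _ => 0) (fun t => 2 * (1 + t ^ 2)⁻¹) ?_
      (integrable_inv_one_add_sq.const_mul 2).integrableOn ?_ ?_
    · simpa using h
    · intro n
      let _ : Fintype (SimpleGraph (Fin n)) := Fintype.ofFinite _
      simp only [hφ, integral_fintype Integrable.of_finite]
      have := continuous_semicircleStieltjes v
      refine (Finset.measurable_fun_sum _ fun G _ => ?_).aestronglyMeasurable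
      unfold smoothedEnergy
      fun_prop
    · intro n
      refine (ae_restrict_mem measurableSet_Ioi).mono fun t ht => ?_
      rw [Real.norm_of_nonneg (hφ0 n t)]
      calc φ n t ≤ ∫ _, 2 * (1 + t ^ 2)⁻¹ ∂(binomialRandom (Fin n) p) :=
            integral_mono .of_finite .of_finite fun G =>
              abs_smoothedEnergy_sub_le p hv (le_of_lt ht) G
        _ = _ := by simp
    · refine (ae_restrict_mem measurableSet_Ioi).mono fun t ht => ?_
      have ht' : 0 < t := ht
      set C := 8 / t ^ 3 * (2 + 1 / t ^ 2) + 2 / t ^ 3 * (t + 2 / t) + 4 / t ^ 4 * (t + 2 / t) +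
          3 / t ^ 2 * (2 + 1 / t ^ 2) with hC
      have hb : Tendsto (fun n : ℕ => Real.sqrt ((Real.sqrt (n : ℝ))⁻¹ * C)) atTop (𝓝 0) := by
        have h1 : Tendsto (fun n : ℕ => (Real.sqrt (n : ℝ))⁻¹) atTop (𝓝 0) :=
          (Real.tendsto_sqrt_atTop.comp tendsto_natCast_atTop_atTop).inv_tendsto_atTop
        have h2 := (Real.continuous_sqrt.tendsto (0 * C)).comp (h1.mul_const C)
        rw [zero_mul, Real.sqrt_zero] at h2
        exact h2
      refine squeeze_zero' (Eventually.of_forall fun n => hφ0 n t) ?_ hb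
      filter_upwards [eventually_ge_atTop 1] with n hn
      have : Nonempty (Fin n) := ⟨⟨0, hn⟩⟩
      have h := integral_abs_smoothedEnergy_sub_le (V := Fin n) p hvdef hv.1 ht'
      rw [Fintype.card_fin] at h
      exact h
  refine squeeze_zero (fun n => integral_nonneg fun G => abs_nonneg _) (fun n => ?_)
    (by simpa using hlim.const_mul (2 / Real.pi))
  have h := integral_abs_energy_sub_le (V := Fin n) p hv
  rw [Fintype.card_fin] at h
  exact h

end SimpleGraph

/-! ### Duality between energy and orthogonal matrices. -/

namespace Matrix

variable {V : Type*} [Fintype V] [DecidableEq V]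

theorem sum_sq_row_of_orthogonal {S : Matrix V V ℝ} (hS : Sᵀ * S = 1) (i : V) :
    ∑ j, S i j ^ 2 = 1 := by
  have hS' : S * Sᵀ = 1 := mul_eq_one_comm.1 hS
  have h := congrFun (congrFun hS' i) i
  rw [mul_apply, one_apply_eq] at h
  rw [← h]
  refine Finset.sum_congr rfl fun j _ => ?_
  rw [transpose_apply, sq]

theorem abs_apply_le_one_of_orthogonal {S : Matrix V V ℝ} (hS : Sᵀ * S = 1) (i j : V) :
    |S i j| ≤ 1 := by
  rw [← sq_le_one_iff_abs_le_one, ← sum_sq_row_of_orthogonal hS i]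
  exact Finset.single_le_sum (f := fun j => S i j ^ 2) (fun j _ => sq_nonneg _) (Finset.mem_univ j)

theorem sum_abs_row_le_of_orthogonal {S : Matrix V V ℝ} (hS : Sᵀ * S = 1) (i : V) :
    ∑ j, |S i j| ≤ Real.sqrt (Fintype.card V) := by
  apply Real.le_sqrt_of_sq_le
  have h := sq_sum_le_card_mul_sum_sq (s := Finset.univ) (f := fun j => |S i j|)
  simp only [sq_abs, sum_sq_row_of_orthogonal hS i, mul_one, Finset.card_univ] at h
  exact h

theorem sq_sum_mul_mul_le_of_orthogonal {S : Matrix V V ℝ} (hS : Sᵀ * S = 1) (x y : V → ℝ) :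
    (∑ i, ∑ j, S i j * (x i * y j)) ^ 2 ≤ (∑ i, x i ^ 2) * ∑ j, y j ^ 2 := by
  have h1 : ∑ i, ∑ j, S i j * (x i * y j) = ∑ i, x i * (S *ᵥ y) i := by
    refine Finset.sum_congr rfl fun i _ => ?_
    rw [mulVec, dotProduct, Finset.mul_sum]
    exact Finset.sum_congr rfl fun j _ => by ring
  have h2 : ∑ i, (S *ᵥ y) i ^ 2 = ∑ j, y j ^ 2 := by
    have h3 : (S *ᵥ y) ⬝ᵥ (S *ᵥ y) = y ⬝ᵥ y := by
      rw [dotProduct_mulVec, vecMul_mulVec, hS, vecMul_one]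
    simpa [dotProduct, sq] using h3
  rw [h1, ← h2]
  exact Finset.sum_mul_sq_le_sq_mul_sq _ _ _

omit [DecidableEq V] in
theorem trace_mul_eq_sum (S M : Matrix V V ℝ) : (S * M).trace = ∑ i, ∑ j, S i j * M j i := by
  simp [trace, mul_apply]

/-- In an eigenbasis of M the trace pairs the eigenvalues with diagonal entries of an orthogonal
matrix, all of modulus at most 1. -/
theorem IsHermitian.abs_trace_mul_le_matrixEnergy {M : Matrix V V ℝ} (hM : M.IsHermitian)
    {S : Matrix V V ℝ} (hS : Sᵀ * S = 1) : |(S * M).trace| ≤ matrixEnergy M hM := by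
  set U := (hM.eigenvectorUnitary : Matrix V V ℝ) with hU
  have hUU : Uᵀ * U = 1 := Unitary.coe_star_mul_self hM.eigenvectorUnitary
  have hUU' : U * Uᵀ = 1 := Unitary.coe_mul_star_self hM.eigenvectorUnitary
  have hW : (Uᵀ * S * U)ᵀ * (Uᵀ * S * U) = 1 := by
    rw [transpose_mul, transpose_mul, transpose_transpose]
    calc _ = Uᵀ * (Sᵀ * (U * Uᵀ) * S) * U := by simp only [mul_assoc]
      _ = 1 := by rw [hUU', mul_one, hS, mul_one, hUU]
  have h1 : (S * M).trace = ∑ k, (Uᵀ * S * U) k k * hM.eigenvalues k := by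
    have h2 : S * M = S * U * diagonal hM.eigenvalues * Uᵀ := by
      conv_lhs => rw [hM.eq_mul_diagonal_mul_transpose]
      simp only [← hU, mul_assoc]
    rw [h2, trace_mul_comm, ← mul_assoc, ← mul_assoc, trace]
    refine Finset.sum_congr rfl fun k _ => ?_
    rw [diag_apply, mul_diagonal]
  rw [h1, matrixEnergy]
  refine (Finset.abs_sum_le_sum_abs _ _).trans (Finset.sum_le_sum fun k _ => ?_)
  rw [abs_mul]
  exact mul_le_of_le_one_left (abs_nonneg _) (abs_apply_le_one_of_orthogonal hW k k)

theorem IsHermitian.exists_trace_mul_eq_matrixEnergy {M : Matrix V V ℝ} (hM : M.IsHermitian) :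
    ∃ S : Matrix V V ℝ, Sᵀ * S = 1 ∧ (S * M).trace = matrixEnergy M hM := by
  set U := (hM.eigenvectorUnitary : Matrix V V ℝ) with hU
  have hUU : Uᵀ * U = 1 := Unitary.coe_star_mul_self hM.eigenvectorUnitary
  have hUU' : U * Uᵀ = 1 := Unitary.coe_mul_star_self hM.eigenvectorUnitary
  -- The sign matrix of M attains the maximum. Zero eigenvalues get sign 1, not 0, so that it stays
  -- orthogonal.
  let d : V → ℝ := fun k => if 0 ≤ hM.eigenvalues k then 1 else -1
  have hdd : diagonal d * diagonal d = 1 := by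
    rw [diagonal_mul_diagonal, ← diagonal_one]
    congr 1
    ext k
    by_cases h : 0 ≤ hM.eigenvalues k <;> simp [d, h]
  refine ⟨U * diagonal d * Uᵀ, ?_, ?_⟩
  · rw [transpose_mul, transpose_mul, transpose_transpose, diagonal_transpose]
    calc _ = U * (diagonal d * (Uᵀ * U) * diagonal d) * Uᵀ := by simp only [mul_assoc]
      _ = 1 := by rw [hUU, mul_one, hdd, mul_one, hUU']
  · have h2 : U * diagonal d * Uᵀ * M = U * (diagonal d * diagonal hM.eigenvalues) * Uᵀ := by
      conv_lhs => rw [hM.eq_mul_diagonal_mul_transpose]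
      rw [← hU]
      calc _ = U * (diagonal d * (Uᵀ * U) * diagonal hM.eigenvalues) * Uᵀ := by
            simp only [mul_assoc]
        _ = _ := by rw [hUU, mul_one]
    rw [h2, trace_mul_comm, ← mul_assoc, hUU, one_mul, diagonal_mul_diagonal, trace_diagonal,
      matrixEnergy]
    refine Finset.sum_congr rfl fun k _ => ?_
    by_cases h : 0 ≤ hM.eigenvalues k
    · simp [d, h, abs_of_nonneg h]
    · simp [d, h, abs_of_neg (not_le.1 h)]

/-- Testing at the optimal S for M replaces any spectral information on K by trace bounds, which can
be proved entrywise. -/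
theorem matrixEnergy_le_add {M N K : Matrix V V ℝ} (hM : M.IsHermitian) (hN : N.IsHermitian)
    (h : M = N + K) {r : ℝ} (hK : ∀ S : Matrix V V ℝ, Sᵀ * S = 1 → |(S * K).trace| ≤ r) :
    matrixEnergy M hM ≤ matrixEnergy N hN + r := by
  obtain ⟨S, hS, hSM⟩ := hM.exists_trace_mul_eq_matrixEnergy
  rw [← hSM, h, mul_add, trace_add]
  exact add_le_add ((le_abs_self _).trans (hN.abs_trace_mul_le_matrixEnergy hS))
    ((le_abs_self _).trans (hK S hS))

theorem abs_matrixEnergy_sub_le {M N K : Matrix V V ℝ} (hM : M.IsHermitian) (hN : N.IsHermitian)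
    (h : M = N + K) {r : ℝ} (hK : ∀ S : Matrix V V ℝ, Sᵀ * S = 1 → |(S * K).trace| ≤ r) :
    |matrixEnergy M hM - matrixEnergy N hN| ≤ r := by
  have h1 := matrixEnergy_le_add hM hN h hK
  have h2 := matrixEnergy_le_add hN hM (K := -K) (by rw [h]; abel) (r := r) fun S hS => by
    rw [mul_neg, trace_neg, abs_neg]; exact hK S hS
  rw [abs_le]
  constructor <;> linarith

theorem matrixEnergy_smul_le {M : Matrix V V ℝ} (hM : M.IsHermitian) (c : ℝ)
    (hcM : (c • M).IsHermitian) : matrixEnergy (c • M) hcM ≤ |c| * matrixEnergy M hM := by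
  obtain ⟨S, hS, hSM⟩ := hcM.exists_trace_mul_eq_matrixEnergy
  rw [← hSM, Matrix.mul_smul, trace_smul, smul_eq_mul]
  refine (le_abs_self _).trans ?_
  rw [abs_mul]
  exact mul_le_mul_of_nonneg_left (hM.abs_trace_mul_le_matrixEnergy hS) (abs_nonneg _)

theorem matrixEnergy_smul {M : Matrix V V ℝ} (hM : M.IsHermitian) (c : ℝ)
    (hcM : (c • M).IsHermitian) : matrixEnergy (c • M) hcM = |c| * matrixEnergy M hM := by
  refine le_antisymm (matrixEnergy_smul_le hM c hcM) ?_
  obtain ⟨S, hS, hSM⟩ := hM.exists_trace_mul_eq_matrixEnergy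
  have h := hcM.abs_trace_mul_le_matrixEnergy hS
  rw [Matrix.mul_smul, trace_smul, smul_eq_mul, abs_mul] at h
  refine le_trans (mul_le_mul_of_nonneg_left ?_ (abs_nonneg c)) h
  rw [← hSM]
  exact le_abs_self _

/-- A matrix with entries `u_i + u_j` has small trace against orthogonal matrices, as it has rank
at most two. -/
theorem abs_sum_mul_add_le_of_orthogonal {S : Matrix V V ℝ} (hS : Sᵀ * S = 1) {u : V → ℝ} {b : ℝ}
    (hb : 0 ≤ b) (hu : ∀ i, |u i| ≤ b) :
    |∑ i, ∑ j, S i j * (u i + u j)| ≤ 2 * (b * Fintype.card V) := by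
  have hsq : ∑ i, u i ^ 2 ≤ Fintype.card V * b ^ 2 := by
    refine (Finset.sum_le_sum fun i _ => sq_le_sq' (abs_le.1 (hu i)).1 (abs_le.1 (hu i)).2).trans ?_
    simp
  have h1 (x y : V → ℝ) (h : (∑ i, x i ^ 2) * ∑ j, y j ^ 2 ≤ (b * Fintype.card V) ^ 2) :
      |∑ i, ∑ j, S i j * (x i * y j)| ≤ b * Fintype.card V :=
    abs_le_of_sq_le_sq ((sq_sum_mul_mul_le_of_orthogonal hS x y).trans h) (by positivity)
  have h2 := h1 u (fun _ => 1) (by simp; nlinarith [(Nat.cast_nonneg (Fintype.card V) : (0:ℝ) ≤ _)])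
  have h3 := h1 (fun _ => 1) u (by simp; nlinarith [(Nat.cast_nonneg (Fintype.card V) : (0:ℝ) ≤ _)])
  have h4 : ∑ i, ∑ j, S i j * (u i + u j) =
      ∑ i, ∑ j, S i j * (u i * 1) + ∑ i, ∑ j, S i j * (1 * u j) := by
    simp only [← Finset.sum_add_distrib]
    refine Finset.sum_congr rfl fun i _ => Finset.sum_congr rfl fun j _ => by ring
  rw [h4]
  refine (abs_add_le _ _).trans ?_
  linarith

/-- A matrix with entries bounded by `|e_i| + |e_j|` has trace at most `2 √n ∑ |e_i|` against
orthogonal matrices. -/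
theorem abs_sum_mul_le_of_orthogonal {S : Matrix V V ℝ} (hS : Sᵀ * S = 1) {e : V → ℝ}
    {B : Matrix V V ℝ} (hB : ∀ i j, |B i j| ≤ |e i| + |e j|) :
    |∑ i, ∑ j, S i j * B i j| ≤ 2 * (Real.sqrt (Fintype.card V) * ∑ i, |e i|) := by
  -- The |e_i| terms use row sums of |S| and the |e_j| terms column sums, so both S and its
  -- transpose must be orthogonal.
  have hS' : Sᵀᵀ * Sᵀ = 1 := by rw [transpose_transpose]; exact mul_eq_one_comm.1 hS
  have h1 : |∑ i, ∑ j, S i j * B i j| ≤ ∑ i, ∑ j, (|S i j| * |e i| + |S i j| * |e j|) := by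
    refine (Finset.abs_sum_le_sum_abs _ _).trans (Finset.sum_le_sum fun i _ => ?_)
    refine (Finset.abs_sum_le_sum_abs _ _).trans (Finset.sum_le_sum fun j _ => ?_)
    rw [abs_mul, ← mul_add]
    exact mul_le_mul_of_nonneg_left (hB i j) (abs_nonneg _)
  have h2 {T : Matrix V V ℝ} (hT : Tᵀ * T = 1) :
      ∑ i, ∑ j, |T i j| * |e i| ≤ Real.sqrt (Fintype.card V) * ∑ i, |e i| := by
    rw [Finset.mul_sum]
    refine Finset.sum_le_sum fun i _ => ?_
    rw [← Finset.sum_mul]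
    exact mul_le_mul_of_nonneg_right (sum_abs_row_le_of_orthogonal hT i) (abs_nonneg _)
  have h3 := h2 hS'
  rw [Finset.sum_comm] at h3
  simp only [transpose_apply] at h3
  simp only [Finset.sum_add_distrib] at h1
  linarith [h2 hS]

theorem abs_sum_diag_le_of_orthogonal {S : Matrix V V ℝ} (hS : Sᵀ * S = 1) {u : V → ℝ} {b : ℝ}
    (hu : ∀ i, |u i| ≤ b) : |∑ i, S i i * u i| ≤ b * Fintype.card V := by
  refine (Finset.abs_sum_le_sum_abs _ _).trans ?_
  calc _ ≤ ∑ _ : V, b := Finset.sum_le_sum fun i _ => by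
        rw [abs_mul]
        exact (mul_le_of_le_one_left (abs_nonneg _) (abs_apply_le_one_of_orthogonal hS i i)).trans
          (hu i)
    _ = _ := by simp [mul_comm]

end Matrix

/-! ### From the degree-distance matrix to the centred adjacency matrix. -/

namespace SimpleGraph

open Matrix

variable {V : Type*} [Fintype V] [DecidableEq V]

open Classical in
/-- For a graph of diameter at most two, the degree-distance energy is, up to lower-order terms,
`2np` times the energy of the centred adjacency matrix. -/
theorem abs_energy_degreeDistanceMatrix_sub_le {p : ℝ} (hp : p ∈ Set.Icc (0 : ℝ) 1)
    (G : SimpleGraph V)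
    (hdist : ∀ i j, i ≠ j → (G.dist i j : ℝ) = 2 - (if G.Adj i j then 1 else 0))
    (hB : (centeredAdj p G).IsHermitian) :
    |matrixEnergy (degreeDistanceMatrix G) (degreeDistanceMatrix_isHermitian G) -
      2 * Fintype.card V * p * matrixEnergy (centeredAdj p G) hB| ≤
    8 * (Fintype.card V : ℝ) ^ 2 + 2 * (Real.sqrt (Fintype.card V) *
      ∑ i, |(G.degree i : ℝ) - Fintype.card V * p|) := by
  obtain ⟨hp0, hp1⟩ := hp
  set N : ℝ := (Fintype.card V : ℝ) with hN
  have hN0 : 0 ≤ N := Nat.cast_nonneg _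
  set d : V → ℝ := fun i => (G.degree i : ℝ) with hd
  set e : V → ℝ := fun i => d i - N * p with he
  set B := centeredAdj p G with hBdef
  have hdN (i : V) : |d i| ≤ N := by
    rw [hd, abs_of_nonneg (Nat.cast_nonneg _), hN]
    exact Nat.cast_le.2 (G.degree_lt_card_verts i).le
  have hcB : (-(2 * N * p) • B).IsHermitian := by
    refine IsHermitian.ext fun i j => ?_
    simp [hBdef, centeredAdj_symm p G i j]
  have hE : 2 * N * p * matrixEnergy B hB = matrixEnergy (-(2 * N * p) • B) hcB := by
    rw [matrixEnergy_smul hB, abs_neg, abs_of_nonneg (by positivity)]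
  rw [hE]
  -- Off the diagonal the entry is (d_i + d_j)(2 - p - B_ij), with d_i + d_j = 2Np + e_i + e_j in
  -- front of B_ij. The last term of K restores the zero diagonal.
  refine abs_matrixEnergy_sub_le _ hcB
    (K := of fun i j => (2 - p) * (d i + d j) - (e i + e j) * B i j -
      if i = j then (2 - p) * (2 * d i) else 0) ?_ ?_
  · ext i j
    simp only [degreeDistanceMatrix, of_apply, Matrix.add_apply, Matrix.smul_apply, smul_eq_mul]
    by_cases hij : i = j
    · subst hij
      simp [hBdef, centeredAdj_self]
      ring
    · rw [hdist i j hij, if_neg hij, hBdef, centeredAdj_of_ne p G hij, he]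
      simp only [hd]
      ring
  · intro S hS
    rw [trace_mul_eq_sum]
    have h1 : ∑ i, ∑ j, S i j * (of fun i j => (2 - p) * (d i + d j) - (e i + e j) * B i j -
      if i = j then (2 - p) * (2 * d i) else 0) j i = (2 - p) * ∑ i, ∑ j, S i j * (d i + d j) -
        ∑ i, ∑ j, S i j * (of fun i j => (e i + e j) * B i j) i j -
        ∑ i, S i i * ((2 - p) * (2 * d i)) := by
      rw [Finset.mul_sum, ← Finset.sum_sub_distrib, ← Finset.sum_sub_distrib]
      refine Finset.sum_congr rfl fun i _ => ?_
      have h2 : S i i * ((2 - p) * (2 * d i)) =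
          ∑ j, S i j * (if j = i then (2 - p) * (2 * d j) else 0) := by
        simp
      rw [h2, Finset.mul_sum, ← Finset.sum_sub_distrib, ← Finset.sum_sub_distrib]
      refine Finset.sum_congr rfl fun j _ => ?_
      simp only [of_apply]
      rw [hBdef, centeredAdj_symm p G j i]
      ring
    have b1 := abs_sum_mul_add_le_of_orthogonal hS hN0 hdN
    have b2 := abs_sum_mul_le_of_orthogonal hS (e := e)
      (B := of fun i j => (e i + e j) * B i j) fun i j => by
        rw [of_apply, abs_mul]
        exact (mul_le_of_le_one_right (abs_nonneg _) (abs_centeredAdj_le ⟨hp0, hp1⟩ G i j)).trans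
          (abs_add_le _ _)
    -- Here (2 - p)·2d_i ≤ 4N, so the diagonal costs 4N². The rank-two part costs another 4N²,
    -- whence the constant 8.
    have b3 := abs_sum_diag_le_of_orthogonal hS (u := fun i => (2 - p) * (2 * d i)) (b := 4 * N)
      fun i => by
        rw [abs_mul, abs_mul, abs_of_nonneg (by linarith : 0 ≤ 2 - p), abs_two]
        nlinarith [hdN i, abs_nonneg (d i)]
    rw [h1]
    refine (abs_sub _ _).trans ((add_le_add_left (abs_sub _ _) _).trans ?_)
    rw [abs_mul, abs_of_nonneg (by linarith : 0 ≤ 2 - p)]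
    have b4 : (2 - p) * |∑ i, ∑ j, S i j * (d i + d j)| ≤ 2 * (2 * (N * N)) := by
      gcongr
      linarith
    have b5 : 4 * N * (Fintype.card V : ℝ) = 4 * N ^ 2 := by rw [← hN]; ring
    rw [b5] at b3
    linarith

end SimpleGraph

/-! ### Common neighbours, degree fluctuations and the total relative error. -/

namespace SimpleGraph

open Matrix

section

variable {V : Type*} [Fintype V] [DecidableEq V]

open Classical in
/-- The indicator of adjacency. -/
noncomputable def adjIndicator (i j : V) (G : SimpleGraph V) : ℝ := if G.Adj i j then 1 else 0

omit [Fintype V] [DecidableEq V] in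
theorem adjIndicator_congr {i j : V} {G H : SimpleGraph V} (h : G.Adj i j ↔ H.Adj i j) :
    adjIndicator i j G = adjIndicator i j H := by
  by_cases hG : G.Adj i j
  · simp [adjIndicator, hG, h.1 hG]
  · simp [adjIndicator, hG, mt h.2 hG]

omit [DecidableEq V] in
/-- Integrating out one edge. -/
theorem integral_resample_of_invariant (p : unitInterval) {i j : V} (hij : i ≠ j) (c : ℝ)
    (f g : SimpleGraph V → ℝ) (hf : ∀ G, f (G ⊔ edge i j) = f G ∧ f (G \ edge i j) = f G)
    (hg : ∀ G, g (G ⊔ edge i j) = g G ∧ g (G \ edge i j) = g G) :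
    ∫ G, (c - adjIndicator i j G * g G) * f G ∂(binomialRandom V p) =
      ∫ G, (c - p * g G) * f G ∂(binomialRandom V p) := by
  rw [integral_binomialRandom_resample p hij]
  congr 1 with G
  have h1 : adjIndicator i j (G ⊔ edge i j) = 1 := by simp [adjIndicator, edge_adj, hij]
  have h2 : adjIndicator i j (G \ edge i j) = 0 := by simp [adjIndicator, edge_adj, hij]
  simp only [h1, h2, (hf G).1, (hf G).2, (hg G).1, (hg G).2, smul_eq_mul]
  ring

/-- Among the factors, only that of k involves the edges ik and jk. Resampling them in turn changes
it to 1 - p·1[jk] and then to 1 - p², leaving the others alone. -/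
theorem integral_prod_one_sub_adjIndicator (p : unitInterval) {i j : V} (hij : i ≠ j)
    (s : Finset V) (hi : i ∉ s) (hj : j ∉ s) :
    ∫ G, ∏ k ∈ s, (1 - adjIndicator i k G * adjIndicator j k G) ∂(binomialRandom V p) =
      (1 - (p : ℝ) ^ 2) ^ s.card := by
  induction s using Finset.induction_on with
  | empty => simp
  | insert k s hk ih =>
    rw [Finset.mem_insert, not_or] at hi hj
    obtain ⟨hik, his⟩ := hi
    obtain ⟨hjk, hjs⟩ := hj
    set f : SimpleGraph V → ℝ := fun G =>
      ∏ l ∈ s, (1 - adjIndicator i l G * adjIndicator j l G) with hf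
    have edge_ne {a l : V} (b : V) (hl : l ∈ s) (hb : b ≠ l) : ¬ (edge b k).Adj a l := by
      intro h
      rcases (edge_adj b k a l).1 h with ⟨⟨-, h⟩ | ⟨-, h⟩, -⟩
      · exact hk (h ▸ hl)
      · exact hb h.symm
    have ne_of_mem {b l : V} (hb : b ∉ s) (hl : l ∈ s) : b ≠ l := fun h => hb (h ▸ hl)
    have hfinv (b : V) (hb : b ∉ s) (G : SimpleGraph V) :
        f (G ⊔ edge b k) = f G ∧ f (G \ edge b k) = f G := by
      constructor <;>
      · refine Finset.prod_congr rfl fun l hl => ?_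
        rw [adjIndicator_congr (i := i) (j := l) (H := G),
          adjIndicator_congr (i := j) (j := l) (H := G)]
        · simp [edge_ne b hl (ne_of_mem hb hl)]
        · simp [edge_ne b hl (ne_of_mem hb hl)]
    have hne : ¬ (edge i k).Adj j k := by
      intro h
      rcases (edge_adj i k j k).1 h with ⟨⟨h, -⟩ | ⟨h, -⟩, -⟩
      · exact hij h.symm
      · exact hjk h
    have h1 := integral_resample_of_invariant p hik 1 f (adjIndicator j k) (hfinv i his)
      fun G => ⟨adjIndicator_congr (by simp [hne]), adjIndicator_congr (by simp [hne])⟩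
    have h2 := integral_resample_of_invariant p hjk 1 f (fun _ => (p : ℝ)) (hfinv j hjs)
      fun G => ⟨rfl, rfl⟩
    simp only [Finset.prod_insert hk]
    rw [h1]
    simp only [mul_comm (p : ℝ) (adjIndicator j k _)]
    rw [h2, integral_const_mul, hf, ih his hjs, Finset.card_insert_of_notMem hk]
    ring

/-- The probability that two given vertices have no common neighbour. -/
theorem binomialRandom_real_no_common_neighbor_le (p : unitInterval) {i j : V} (hij : i ≠ j) :
    (binomialRandom V p).real {G | ∀ k, ¬ (G.Adj i k ∧ G.Adj j k)} ≤
      (1 - (p : ℝ) ^ 2) ^ (Fintype.card V - 2) := by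
  set s : Finset V := (Finset.univ.erase i).erase j with hs
  have hcard : s.card = Fintype.card V - 2 := by
    rw [hs, Finset.card_erase_of_mem (by simp [hij.symm]), Finset.card_erase_of_mem (by simp),
      Finset.card_univ]
    omega
  rw [← hcard, ← integral_prod_one_sub_adjIndicator p hij s (by simp [hs]) (by simp [hs]),
    ← integral_indicator_one (Set.toFinite _).measurableSet]
  refine integral_mono .of_finite .of_finite fun G => ?_
  have hfac (k : V) : 0 ≤ 1 - adjIndicator i k G * adjIndicator j k G := by
    by_cases h1 : G.Adj i k <;> by_cases h2 : G.Adj j k <;> simp [adjIndicator, h1, h2]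
  refine Set.indicator_apply_le' (fun hG => ?_) fun _ => Finset.prod_nonneg fun k _ => hfac k
  rw [Finset.prod_eq_one fun k _ => ?_]
  · rfl
  · have := hG k
    by_cases h1 : G.Adj i k <;> by_cases h2 : G.Adj j k <;> simp_all [adjIndicator]

theorem binomialRandom_real_exists_no_common_neighbor_le (p : unitInterval) :
    (binomialRandom V p).real {G | ∃ i j, i ≠ j ∧ ∀ k, ¬ (G.Adj i k ∧ G.Adj j k)} ≤
      (Fintype.card V : ℝ) ^ 2 * (1 - (p : ℝ) ^ 2) ^ (Fintype.card V - 2) := by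
  have hp2 : 0 ≤ 1 - (p : ℝ) ^ 2 := by
    obtain ⟨h0, h1⟩ := p.2
    nlinarith
  have hsub : {G : SimpleGraph V | ∃ i j, i ≠ j ∧ ∀ k, ¬ (G.Adj i k ∧ G.Adj j k)} ⊆
      ⋃ x ∈ (Finset.univ.filter fun x : V × V => x.1 ≠ x.2),
        {G | ∀ k, ¬ (G.Adj x.1 k ∧ G.Adj x.2 k)} := by
    rintro G ⟨i, j, hij, h⟩
    simp only [Set.mem_iUnion]
    exact ⟨(i, j), by simpa using hij, h⟩
  refine (measureReal_mono hsub (measure_ne_top _ _)).trans ((measureReal_biUnion_finset_le _ _).trans ?_)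
  calc _ ≤ ∑ x ∈ (Finset.univ.filter fun x : V × V => x.1 ≠ x.2),
        (1 - (p : ℝ) ^ 2) ^ (Fintype.card V - 2) := by
        refine Finset.sum_le_sum fun x hx => ?_
        exact binomialRandom_real_no_common_neighbor_le p (Finset.mem_filter.1 hx).2
    _ ≤ ∑ x : V × V, (1 - (p : ℝ) ^ 2) ^ (Fintype.card V - 2) :=
        Finset.sum_le_sum_of_subset_of_nonneg (Finset.filter_subset _ _)
          fun _ _ _ => by positivity
    _ = _ := by simp [sq]

theorem connected_of_common_neighbors {V : Type*} [Nonempty V] {G : SimpleGraph V}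
    (h : ∀ i j, i ≠ j → ∃ k, G.Adj i k ∧ G.Adj j k) : G.Connected := by
  refine ⟨fun i j => ?_⟩
  by_cases hij : i = j
  · rw [hij]
  · obtain ⟨k, h1, h2⟩ := h i j hij
    exact h1.reachable.trans h2.symm.reachable

open Classical in
theorem dist_eq_of_common_neighbors {V : Type*} [Nonempty V] {G : SimpleGraph V}
    (h : ∀ i j, i ≠ j → ∃ k, G.Adj i k ∧ G.Adj j k) {i j : V} (hij : i ≠ j) :
    (G.dist i j : ℝ) = 2 - (if G.Adj i j then 1 else 0) := by
  by_cases ha : G.Adj i j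
  · rw [dist_eq_one_iff_adj.2 ha, if_pos ha]; norm_num
  · obtain ⟨k, h1, h2⟩ := h i j hij
    have hle : G.dist i j ≤ 2 := by
      simpa using dist_le (Walk.cons h1 (Walk.cons h2.symm Walk.nil))
    have h0 : 0 < G.dist i j := (connected_of_common_neighbors h).pos_dist_of_ne hij
    have hne : G.dist i j ≠ 1 := fun hh => ha (dist_eq_one_iff_adj.1 hh)
    have : G.dist i j = 2 := by omega
    rw [this, if_neg ha]; norm_num

/-- Integration by parts shows that distinct entries of a row are uncorrelated; this gives row sums,
hence degrees, variance at most n. -/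
theorem integral_centeredAdj_mul (p : unitInterval) (i j k : V) :
    ∫ G, centeredAdj p G i j * centeredAdj p G i k ∂(binomialRandom V p) ≤ if j = k then 1 else 0 := by
  by_cases hij : i = j
  · subst hij
    simp only [centeredAdj_self, zero_mul, integral_zero]
    split_ifs <;> norm_num
  · have h := integral_centeredAdj_smul p hij (fun G => centeredAdj p G i k)
    simp only [smul_eq_mul] at h
    rw [h]
    have h1 (G : SimpleGraph V) :
        centeredAdj p (G ⊔ edge i j) i k - centeredAdj p (G \ edge i j) i k =
          if j = k then 1 else 0 := by
      rw [centeredAdj_sup_edge _ G hij]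
      simp [single_apply, Ne.symm hij]
    simp only [h1, integral_const, probReal_univ, one_smul]
    obtain ⟨h0, h1⟩ := p.2
    split_ifs
    · nlinarith
    · simp

theorem integral_sq_sum_centeredAdj_le (p : unitInterval) (i : V) :
    ∫ G, (∑ j, centeredAdj p G i j) ^ 2 ∂(binomialRandom V p) ≤ Fintype.card V := by
  simp only [sq, Finset.sum_mul_sum]
  rw [integral_finsetSum _ (fun _ _ => .of_finite)]
  simp only [integral_finsetSum _ (fun _ _ => Integrable.of_finite)]
  refine (Finset.sum_le_sum fun j _ => Finset.sum_le_sum fun k _ =>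
    integral_centeredAdj_mul p i j k).trans ?_
  simp

open Classical in
theorem degree_sub_eq (p : ℝ) (G : SimpleGraph V) (i : V) :
    (G.degree i : ℝ) - Fintype.card V * p = ∑ j, centeredAdj p G i j - p := by
  have h1 (j : V) : centeredAdj p G i j =
      (if G.Adj i j then (1 : ℝ) else 0) - p + (if i = j then p else 0) := by
    by_cases hij : i = j
    · subst hij; simp [centeredAdj_self]
    · simp [centeredAdj_of_ne p G hij, hij]
  have h2 : (G.degree i : ℝ) = ∑ j, if G.Adj i j then (1 : ℝ) else 0 := by
    rw [Finset.sum_boole, ← card_neighborFinset_eq_degree, neighborFinset_eq_filter]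
  simp only [h1, Finset.sum_add_distrib, Finset.sum_sub_distrib, ← h2]
  simp

open Classical in
theorem integral_abs_degree_sub_le (p : unitInterval) (i : V) :
    ∫ G : SimpleGraph V, |(G.degree i : ℝ) - Fintype.card V * p| ∂(binomialRandom V p) ≤
      Real.sqrt (Fintype.card V) + 1 := by
  have h1 : ∫ G : SimpleGraph V, |(G.degree i : ℝ) - Fintype.card V * p| ∂(binomialRandom V p) ≤
      ∫ G : SimpleGraph V, (|∑ j, centeredAdj p G i j| + 1) ∂(binomialRandom V p) := by
    refine integral_mono .of_finite .of_finite fun G => ?_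
    simp only [degree_sub_eq]
    refine (abs_sub _ _).trans ?_
    rw [abs_of_nonneg p.2.1]
    linarith [p.2.2]
  refine h1.trans ?_
  rw [integral_add .of_finite .of_finite]
  simp only [integral_const, probReal_univ, one_smul]
  gcongr
  exact (integral_abs_le_sqrt_integral_sq _ _).trans
    (Real.sqrt_le_sqrt (integral_sq_sum_centeredAdj_le p i))

open Classical in
/-- A random bound for the relative error of the degree-distance energy. -/
noncomputable def relativeEnergyError (p : ℝ) (G : SimpleGraph V) : ℝ :=
  8 * (Real.sqrt (Fintype.card V))⁻¹ +
    2 * ((Fintype.card V : ℝ)⁻¹ ^ 2 * ∑ i, |(G.degree i : ℝ) - Fintype.card V * p|) +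
    2 * |(Fintype.card V : ℝ)⁻¹ * matrixEnergy (scaledAdj p G) (scaledAdj_isHermitian p G) -
      8 / (3 * Real.pi) * Real.sqrt (p * (1 - p))|

theorem relativeEnergyError_nonneg (p : ℝ) (G : SimpleGraph V) : 0 ≤ relativeEnergyError p G := by
  unfold relativeEnergyError
  positivity

theorem integral_relativeEnergyError_le [Nonempty V] (p : unitInterval) :
    ∫ G : SimpleGraph V, relativeEnergyError p G ∂(binomialRandom V p) ≤
      12 * (Real.sqrt (Fintype.card V))⁻¹ + 2 * ∫ G : SimpleGraph V, |(Fintype.card V : ℝ)⁻¹ *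
        matrixEnergy (scaledAdj p G) (scaledAdj_isHermitian p G) -
        8 / (3 * Real.pi) * Real.sqrt (p * (1 - p))| ∂(binomialRandom V p) := by
  classical
  have hN : (1 : ℝ) ≤ Fintype.card V := by exact_mod_cast Fintype.card_pos (α := V)
  unfold relativeEnergyError
  rw [integral_add .of_finite .of_finite, integral_add .of_finite .of_finite]
  simp only [integral_const_mul]
  rw [integral_finsetSum _ (fun _ _ => .of_finite)]
  simp only [integral_const, probReal_univ, one_smul]
  have h1 := Finset.sum_le_sum fun (i : V) (_ : i ∈ Finset.univ) => integral_abs_degree_sub_le p i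
  rw [Finset.sum_const, Finset.card_univ, nsmul_eq_mul] at h1
  set N : ℝ := (Fintype.card V : ℝ) with hNdef
  set r := Real.sqrt N with hr
  have hr1 : 1 ≤ r := Real.one_le_sqrt.2 hN
  have hrr : N = r ^ 2 := (Real.sq_sqrt (by linarith)).symm
  -- Uses r + 1 ≤ 2r. Doubled, this adds 4 to the constant 8, giving 12.
  have h2 : N⁻¹ ^ 2 * (N * (r + 1)) ≤ 2 * r⁻¹ := by
    rw [hrr]
    field_simp
    linarith
  have h3 := mul_le_mul_of_nonneg_left h1 (by positivity : 0 ≤ N⁻¹ ^ 2)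
  gcongr
  linarith

theorem rpow_five_halves (n : ℕ) : (n : ℝ) ^ (5 / 2 : ℝ) = (n : ℝ) ^ 2 * Real.sqrt n := by
  rcases Nat.eq_zero_or_pos n with rfl | hn
  · simp
  · have h : (0 : ℝ) < n := by exact_mod_cast hn
    rw [Real.sqrt_eq_rpow, ← Real.rpow_natCast (n : ℝ) 2, ← Real.rpow_add h]
    norm_num

theorem abs_energy_degreeDistanceMatrix_sub_le_relativeEnergyError [Nonempty V]
    {p : ℝ} (hp : p ∈ Set.Icc (0 : ℝ) 1) {G : SimpleGraph V}
    (h : ∀ i j, i ≠ j → ∃ k, G.Adj i k ∧ G.Adj j k) :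
    |matrixEnergy (degreeDistanceMatrix G) (degreeDistanceMatrix_isHermitian G) -
      16 / (3 * Real.pi) * p * Real.sqrt (p * (1 - p)) * (Fintype.card V : ℝ) ^ (5 / 2 : ℝ)| ≤
    relativeEnergyError p G * (Fintype.card V : ℝ) ^ (5 / 2 : ℝ) := by
  classical
  have hB : (centeredAdj p G).IsHermitian := by
    refine IsHermitian.ext fun i j => ?_
    simp [centeredAdj_symm p G i j]
  have h1 := abs_energy_degreeDistanceMatrix_sub_le hp G
    (fun i j hij => dist_eq_of_common_neighbors h hij) hB
  have hN : (1 : ℝ) ≤ Fintype.card V := by exact_mod_cast Fintype.card_pos (α := V)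
  have hX : matrixEnergy (scaledAdj p G) (scaledAdj_isHermitian p G) =
      (Real.sqrt (Fintype.card V))⁻¹ * matrixEnergy (centeredAdj p G) hB := by
    have := matrixEnergy_smul hB (Real.sqrt (Fintype.card V))⁻¹ (scaledAdj_isHermitian p G)
    rw [abs_of_nonneg (by positivity)] at this
    exact this
  unfold relativeEnergyError
  rw [hX, rpow_five_halves]
  set E := matrixEnergy (centeredAdj p G) hB with hE
  set DD := matrixEnergy (degreeDistanceMatrix G) (degreeDistanceMatrix_isHermitian G)
  set N : ℝ := (Fintype.card V : ℝ) with hNdef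
  set D := ∑ i, |(G.degree i : ℝ) - N * p| with hD
  set r := Real.sqrt N with hr
  have hr1 : 1 ≤ r := Real.one_le_sqrt.2 hN
  have hrr : N = r ^ 2 := (Real.sq_sqrt (by linarith)).symm
  set σ := Real.sqrt (p * (1 - p)) with hσ
  have hN0 : 0 < N := by linarith
  have hr0 : 0 < r := by linarith
  -- The limit 8/(3π) of the scaled energy, multiplied by 2p, produces 16/(3π)·p.
  have e1 : DD - 16 / (3 * Real.pi) * p * σ * (N ^ 2 * r) = (DD - 2 * N * p * E) +
      2 * p * (N ^ 2 * r) * (N⁻¹ * (r⁻¹ * E) - 8 / (3 * Real.pi) * σ) := by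
    have h5 : 2 * p * (N ^ 2 * r) * (N⁻¹ * (r⁻¹ * E)) = 2 * N * p * E := by
      field_simp
    rw [mul_sub, h5]
    ring
  rw [e1]
  refine (abs_add_le _ _).trans ?_
  rw [abs_mul, abs_of_nonneg (mul_nonneg (mul_nonneg zero_le_two hp.1) (by positivity))]
  have e2 : 8 * r⁻¹ * (N ^ 2 * r) = 8 * N ^ 2 := by field_simp
  have e3 : 2 * (N⁻¹ ^ 2 * D) * (N ^ 2 * r) = 2 * (r * D) := by field_simp
  rw [add_mul, add_mul, e2, e3]
  refine add_le_add h1 ?_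
  have h6 : 2 * p * (N ^ 2 * r) ≤ 2 * (N ^ 2 * r) := by
    refine mul_le_mul_of_nonneg_right ?_ (by positivity)
    linarith [hp.2]
  calc _ ≤ 2 * (N ^ 2 * r) * |N⁻¹ * (r⁻¹ * E) - 8 / (3 * Real.pi) * σ| :=
        mul_le_mul_of_nonneg_right h6 (abs_nonneg _)
    _ = _ := by ring

end

theorem tendsto_sq_mul_pow_sub_two {a : ℝ} (ha : a ∈ Set.Ico (0 : ℝ) 1) :
    Tendsto (fun n : ℕ => (n : ℝ) ^ 2 * a ^ (n - 2)) atTop (𝓝 0) := by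
  -- The shift removes the truncated subtraction, and (n + 2)² expands as n² + 4n + 4.
  rw [← tendsto_add_atTop_iff_nat 2]
  have habs : |a| < 1 := by rw [abs_of_nonneg ha.1]; exact ha.2
  have h0 := tendsto_pow_const_mul_const_pow_of_abs_lt_one 0 habs
  have h1 := tendsto_pow_const_mul_const_pow_of_abs_lt_one 1 habs
  have h2 := tendsto_pow_const_mul_const_pow_of_abs_lt_one 2 habs
  have h := (h2.add (h1.const_mul 4)).add (h0.const_mul 4)
  simp only [mul_zero, add_zero] at h
  refine h.congr fun n => ?_
  simp only [Nat.add_sub_cancel]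
  push_cast
  ring

end SimpleGraph

/-! ### Conclusion by the union bound and Markov's inequality. -/

open SimpleGraph in
theorem corollary3p6 (p : ℝ) (hp : p ∈ Set.Ioo (0 : ℝ) 1) :
    ∀ ε : ℝ, 0 < ε →
      Tendsto
        (fun n : ℕ =>
          (SimpleGraph.binomialRandom (Fin n) ⟨p, hp.1.le, hp.2.le⟩).real
            {G : SimpleGraph (Fin n) | G.Connected ∧
              |matrixEnergy (degreeDistanceMatrix G) (degreeDistanceMatrix_isHermitian G)
                  - 16 / (3 * Real.pi) * p * Real.sqrt (p * (1 - p)) * (n : ℝ) ^ (5 / 2 : ℝ)|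
                ≤ ε * (n : ℝ) ^ (5 / 2 : ℝ)})
        atTop (𝓝 1) := by
  intro ε hε
  set P : unitInterval := ⟨p, hp.1.le, hp.2.le⟩ with hP
  have hPp : (P : ℝ) = p := rfl
  -- The failure bound: the first term is for a pair without a common neighbour, the second is
  -- Markov's inequality at level ε for the relative error.
  set b : ℕ → ℝ := fun n => (n : ℝ) ^ 2 * (1 - p ^ 2) ^ (n - 2) +
    ε⁻¹ * (12 * (Real.sqrt (n : ℝ))⁻¹ + 2 * ∫ G, |(n : ℝ)⁻¹ *
      matrixEnergy (scaledAdj p G) (scaledAdj_isHermitian p G) -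
      8 / (3 * Real.pi) * Real.sqrt (p * (1 - p))| ∂(binomialRandom (Fin n) P)) with hb
  have hb0 : Tendsto b atTop (𝓝 0) := by
    have h1 := tendsto_sq_mul_pow_sub_two (a := 1 - p ^ 2)
      ⟨by nlinarith [hp.1, hp.2], by nlinarith [hp.1]⟩
    have h2 : Tendsto (fun n : ℕ => (Real.sqrt (n : ℝ))⁻¹) atTop (𝓝 0) :=
      (Real.tendsto_sqrt_atTop.comp tendsto_natCast_atTop_atTop).inv_tendsto_atTop
    have h3 := tendsto_integral_abs_energy_sub P hp
    have h4 := h1.add (((h2.const_mul 12).add (h3.const_mul 2)).const_mul ε⁻¹)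
    simpa using h4
  refine tendsto_of_tendsto_of_tendsto_of_le_of_le' (g := fun n => 1 - b n)
    (by simpa using hb0.const_sub 1) tendsto_const_nhds ?_
    (Eventually.of_forall fun n => measureReal_le_one)
  filter_upwards [eventually_ge_atTop 1] with n hn
  have : Nonempty (Fin n) := ⟨⟨0, hn⟩⟩
  set μ := binomialRandom (Fin n) P with hμ
  set S := {G : SimpleGraph (Fin n) | G.Connected ∧
    |matrixEnergy (degreeDistanceMatrix G) (degreeDistanceMatrix_isHermitian G)
      - 16 / (3 * Real.pi) * p * Real.sqrt (p * (1 - p)) * (n : ℝ) ^ (5 / 2 : ℝ)|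
      ≤ ε * (n : ℝ) ^ (5 / 2 : ℝ)} with hS
  have hsub : Sᶜ ⊆ {G | ∃ i j, i ≠ j ∧ ∀ k, ¬ (G.Adj i k ∧ G.Adj j k)} ∪
      {G | ε ≤ relativeEnergyError p G} := by
    intro G hG
    by_contra hcon
    rw [Set.mem_union, not_or] at hcon
    obtain ⟨h1, h2⟩ := hcon
    have h1' : ∀ i j, i ≠ j → ∃ k, G.Adj i k ∧ G.Adj j k := by
      intro i j hij
      by_contra hk
      exact h1 ⟨i, j, hij, not_exists.1 hk⟩
    have h2' : relativeEnergyError p G < ε := not_le.1 h2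
    refine hG ⟨connected_of_common_neighbors h1', ?_⟩
    have h3 := abs_energy_degreeDistanceMatrix_sub_le_relativeEnergyError
      ⟨hp.1.le, hp.2.le⟩ h1'
    rw [Fintype.card_fin] at h3
    exact h3.trans (mul_le_mul_of_nonneg_right h2'.le (by positivity))
  have hA := binomialRandom_real_exists_no_common_neighbor_le (V := Fin n) P
  have hM := mul_meas_ge_le_integral_of_nonneg (μ := μ) (f := relativeEnergyError p)
    (Eventually.of_forall fun G => relativeEnergyError_nonneg p G) .of_finite ε
  have hI := integral_relativeEnergyError_le (V := Fin n) P
  rw [Fintype.card_fin] at hA hI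
  have hM' : μ.real {G | ε ≤ relativeEnergyError p G} ≤
      ε⁻¹ * ∫ G, relativeEnergyError p G ∂μ := by
    rw [le_inv_mul_iff₀ hε]
    exact hM
  have hI' := mul_le_mul_of_nonneg_left hI (inv_nonneg.2 hε.le)
  have hc : μ.real Sᶜ ≤ b n :=
    (measureReal_mono hsub).trans ((measureReal_union_le _ _).trans
      (add_le_add hA (hM'.trans hI')))
  rw [probReal_compl_eq_one_sub (Set.toFinite S).measurableSet] at hc
  linarith
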